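/- **Theorem 7.4.** Let $\star\in\{\top,\mathsf H\}$ and consider the periodic system in the unknowns $X_1,\dots,X_r\in\mathbb C^{n\times n}$ $$A_kX_kB_k-C_kX_{k+1}D_k=E_k\quad(k=1,\dots,r),\qquad X_{r+1}:=X_1^\star,$$ with coefficients in $\mathbb C^{n\times n}$ such that $A_k,C_k,B_k^\top,D_k^\top$ are upper triangular. Let $M\mathcal X=\mathcal E$ be its vectorized form: for $\star=\top$, $\mathcal X$ and $\mathcal E$ stack the vectors $\operatorname{vec}X_k$ and $\operatorname{vec}E_k$, and $M\in\mathbb C^{rn^2\times rn^2}$; for $\star=\mathsf H$, $\mathcal X$ and $\mathcal E$ consist of the real and imaginary parts of these vectors, and $M\in\mathbb R^{2rn^2\times 2rn^2}$. The following algorithm is carried out in floating point arithmetic that obeys the standard model with unit roundoff $u$: each computed operation satisfies $\mathrm{fl}(x\circ y)=(x\circ y)(1+\delta)$ with $|\delta|\le u$ (and likewise for real square roots and for $|x|^2$). *Algorithm.* Store $X_k$, $X_k^B$ (for $X_kB_k$) and $X_k^D$ (for $X_{k+1}D_k$), all initially zero. Go through the pairs $(i,j)$, $1\le j\le i\le n$,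 in the reverse of the order $(1,1),(2,1),(2,2),(3,1),\dots,(n,n)$. For each pair: 1. Compute, for all $k$, the right-hand sides $(E_k)_{ij}-v_{ijk}$ and $(E_k)_{ji}-v_{jik}$, where $$v_{ijk}=\big[(A_k)_{ii}\,(e_i^\top X_k)(B_ke_j)+(e_i^\top A_k)(X_k^Be_j)\big]-\big[(C_k)_{ii}\,(e_i^\top X_{k+1})(D_ke_j)+(e_i^\top C_k)(X_k^De_j)\big].$$ 2. Form and solve the small linear system for the entries $(X_k)_{ij}$, $(X_k)_{ji}$ ($k=1,\dots,r$) that is left when all other entries are known. Its matrix is cyclic bidiagonal, with entries $(A_k)_{ii}(B_k)_{jj}$ and $-(C_k)_{ii}(D_k)_{jj}$ (and those with $i,j$ exchanged), of order $r$ if $i=j$ and $2r$ if $i\ne j$; for $\star=\mathsf H$ it is written over $\mathbb R$ with $2\times2$ blocks. It is solved by a QR factorization with Givens rotations, which act within a diagonal block or between a diagonal block and the last one, followed by back substitution. 3. Store the solution, and compute the entries $(i,j)$ and $(j,i)$ of $X_k^B$ and $X_k^D$ as scalar products. Write $\gamma_k:=\dfrac{cku}{1-cku}$. There is an absolute constant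 $c>0$ such that, for all $n$, $r$, $u\ge0$ with $cru<1$ and $cn^2u<1$, all such systems and all such arithmetics, the following holds. If the algorithm runs to completion (no pivot of a computed triangular factor is zero), then the computed $\tilde{\mathcal X}$ satisfies $$(M+\delta M)\tilde{\mathcal X}=\mathcal E+\delta\mathcal E,\qquad \|\delta M\|_2\le\big(r\gamma_r+\gamma_{n^2}(1+r\gamma_r)\big)\,\mu,\qquad \|\delta\mathcal E\|_2\le\gamma_{n^2}\|\mathcal E\|_2,$$ for some $\delta M$, $\delta\mathcal E$ (complex for $\star=\top$, real for $\star=\mathsf H$), where $\mu=\|M\|_2$ if $r\ne1$. If $r=1$, where both terms of the only equation contain the same unknown and can cancel in $M$, then $\mu=\|B_1^\top\otimes A_1\|_2+\|D_1^\top\otimes C_1\|_2$. -/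

import Mathlib

open scoped Kronecker

noncomputable section

namespace StarSylvester

/-! ## The standard model of floating point arithmetic -/

/-- `y` is a rounded version of `x` with unit roundoff `u`: `y = x (1 + δ)` with `|δ| ≤ u`. -/
def Rounds {𝕜 : Type} [RCLike 𝕜] (u : ℝ) (x y : 𝕜) : Prop :=
  ∃ δ : 𝕜, ‖δ‖ ≤ u ∧ y = x * (1 + δ)

/-- The standard model of floating point arithmetic with unit roundoff `u` over `𝕜 = ℝ` or `ℂ`:
the computed value of `x op y` is `(x op y)(1 + δ)` with `|δ| ≤ u`; `absSq x` is the computed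
`|x|²`, and `radd`, `rsqrt` are the computed sum and square root of real numbers. Negation and
complex conjugation are exact. (When complex operations are carried out in real arithmetic, the
model holds with `u` replaced by a small multiple of `u`.) -/
structure FloatArith (𝕜 : Type) [RCLike 𝕜] (u : ℝ) where
  add : 𝕜 → 𝕜 → 𝕜
  sub : 𝕜 → 𝕜 → 𝕜
  mul : 𝕜 → 𝕜 → 𝕜
  div : 𝕜 → 𝕜 → 𝕜
  absSq : 𝕜 → ℝ
  radd : ℝ → ℝ → ℝ
  rsqrt : ℝ → ℝ
  add_spec : ∀ x y, Rounds u (x + y) (add x y)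
  sub_spec : ∀ x y, Rounds u (x - y) (sub x y)
  mul_spec : ∀ x y, Rounds u (x * y) (mul x y)
  div_spec : ∀ x y, y ≠ 0 → Rounds u (x / y) (div x y)
  absSq_spec : ∀ x, Rounds u (‖x‖ ^ 2) (absSq x)
  radd_spec : ∀ x y, Rounds u (x + y) (radd x y)
  rsqrt_spec : ∀ x, 0 ≤ x → Rounds u (Real.sqrt x) (rsqrt x)

/-- `γ_k = c k u / (1 - c k u)`. -/
def gam (c u : ℝ) (k : ℕ) : ℝ := c * k * u / (1 - c * k * u)

section LinearAlgebra

variable {𝕜 : Type} [RCLike 𝕜] {u : ℝ} (fl : FloatArith 𝕜 u) {N : ℕ}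

/-- The computed scalar product `x₁ y₁ + ⋯ + x_N y_N` (no conjugation). -/
def FloatArith.dot (x y : Fin N → 𝕜) : 𝕜 :=
  (List.finRange N).foldl (fun s t => fl.add s (fl.mul (x t) (y t))) 0

/-- The computed `(c, s)`, with `c = conj f / ρ`, `s = conj g / ρ`, `ρ = √(|f|² + |g|²)`, of the
plane rotation `[c s; -conj s, conj c]` that maps `(f, g)` to `(ρ, 0)`. -/
def FloatArith.rotation (f g : 𝕜) : 𝕜 × 𝕜 :=
  let ρ : ℝ := fl.rsqrt (fl.radd (fl.absSq f) (fl.absSq g))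
  (fl.div (star f) (ρ : 𝕜), fl.div (star g) (ρ : 𝕜))

/-- The computed image of the vector `v` under the rotation `(c, s)` acting on the rows `p, q`. -/
def FloatArith.rotate (cs : 𝕜 × 𝕜) (p q : Fin N) (v : Fin N → 𝕜) : Fin N → 𝕜 := fun i =>
  if i = p then fl.add (fl.mul cs.1 (v p)) (fl.mul cs.2 (v q))
  else if i = q then fl.sub (fl.mul (star cs.1) (v q)) (fl.mul (star cs.2) (v p))
  else v i

/-- One Givens step on a matrix: rotate the rows `p, q` so that entry `(q, p)` is annihilated
(and stored as an exact zero). Nothing is done when that entry is zero already. -/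
def FloatArith.givensStep (p q : Fin N) (R : Matrix (Fin N) (Fin N) 𝕜) :
    Matrix (Fin N) (Fin N) 𝕜 :=
  if R q p = 0 then R
  else fun i j => if i = q ∧ j = p then 0
    else fl.rotate (fl.rotation (R p p) (R q p)) p q (fun i' => R i' j) i

/-- The right-hand side of the same Givens step. -/
def FloatArith.givensStepRhs (p q : Fin N) (R : Matrix (Fin N) (Fin N) 𝕜) (y : Fin N → 𝕜) :
    Fin N → 𝕜 :=
  if R q p = 0 then y else fl.rotate (fl.rotation (R p p) (R q p)) p q y

/-- The computed triangular factor after a sequence of Givens steps. -/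
def FloatArith.givensFactor :
    List (Fin N × Fin N) → Matrix (Fin N) (Fin N) 𝕜 → Matrix (Fin N) (Fin N) 𝕜
  | [], R => R
  | (p, q) :: l, R => FloatArith.givensFactor l (fl.givensStep p q R)

/-- The computed right-hand side after the same sequence of Givens steps. -/
def FloatArith.givensRhs :
    List (Fin N × Fin N) → Matrix (Fin N) (Fin N) 𝕜 → (Fin N → 𝕜) → Fin N → 𝕜
  | [], _, y => y
  | (p, q) :: l, R, y =>
      FloatArith.givensRhs l (fl.givensStep p q R) (fl.givensStepRhs p q R y)

/-- Back substitution for the upper triangular system `R x = y`. -/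
def FloatArith.backSubst (R : Matrix (Fin N) (Fin N) 𝕜) (y : Fin N → 𝕜) : Fin N → 𝕜 :=
  (List.finRange N).reverse.foldl
    (fun x i => Function.update x i
      (fl.div
        (((List.finRange N).filter (fun j => i < j)).foldl
          (fun s j => fl.sub s (fl.mul (R i j) (x j))) (y i))
        (R i i))) 0

/-- The rotations `(p, q)` used for a block cyclic bidiagonal matrix with `b × b` blocks, in
lexicographic order: `q > p` lies in the diagonal block of `p` or in the last block. For `b = 1`
these are the `N - 1` rotations of the rows `p` and `N`. -/
def rotationList (N b : ℕ) : List (Fin N × Fin N) :=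
  (List.finRange N).flatMap fun p =>
    ((List.finRange N).filter
      (fun q => p < q ∧ (q.val / b = p.val / b ∨ N ≤ q.val + b))).map fun q => (p, q)

/-- The computed triangular factor of a block cyclic bidiagonal matrix with `b × b` blocks. -/
def FloatArith.cyclicFactor (b : ℕ) (M : Matrix (Fin N) (Fin N) 𝕜) :
    Matrix (Fin N) (Fin N) 𝕜 :=
  fl.givensFactor (rotationList N b) M

/-- The Givens-QR solver for a system `M x = y` with block cyclic bidiagonal matrix `M`. -/
def FloatArith.cyclicSolve (b : ℕ) (M : Matrix (Fin N) (Fin N) 𝕜) (y : Fin N → 𝕜) : Fin N → 𝕜 :=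
  fl.backSubst (fl.cyclicFactor b M) (fl.givensRhs (rotationList N b) M y)

end LinearAlgebra

/-! ## Periodic systems and their vectorized form -/

/-- The two meanings of `⋆`: transpose and conjugate transpose. -/
inductive StarKind where
  | T : StarKind
  | H : StarKind

/-- `X^⋆`. -/
def StarKind.mat {n : ℕ} : StarKind → Matrix (Fin n) (Fin n) ℂ → Matrix (Fin n) (Fin n) ℂ
  | .T, X => X.transpose
  | .H, X => X.conjTranspose

/-- The data of the periodic system `A_k X_k B_k - C_k X_{k+1} D_k = E_k` (`k = 1, …, r`), where
`X_{r+1}` stands for `X_1^⋆`. The index `k` runs through `0, …, r - 1` here. -/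
structure PeriodicSystem (r n : ℕ) where
  A : Fin r → Matrix (Fin n) (Fin n) ℂ
  B : Fin r → Matrix (Fin n) (Fin n) ℂ
  C : Fin r → Matrix (Fin n) (Fin n) ℂ
  D : Fin r → Matrix (Fin n) (Fin n) ℂ
  E : Fin r → Matrix (Fin n) (Fin n) ℂ

/-- `X_{k+1}`, with the convention `X_{r+1} = X_1^⋆`. -/
def nextX {r n : ℕ} (st : StarKind) (X : Fin r → Matrix (Fin n) (Fin n) ℂ) (k : Fin r) :
    Matrix (Fin n) (Fin n) ℂ :=
  if h : k.val + 1 < r then X ⟨k.val + 1, h⟩ else st.mat (X ⟨0, k.pos⟩)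

/-- Indices of the vectorized unknown: `(k, (j, i))` is the entry `(i, j)` of `X_k`. -/
abbrev Idx (r n : ℕ) : Type := Fin r × (Fin n × Fin n)

/-- The columns of `X_1, …, X_r` stacked into one vector. -/
def stack {r n : ℕ} (X : Fin r → Matrix (Fin n) (Fin n) ℂ) : Idx r n → ℂ :=
  fun a => (X a.1).vec a.2

/-- The real and imaginary parts of the entries of a complex vector. -/
def realStack {ι : Type} (x : ι → ℂ) : ι × Fin 2 → ℝ :=
  fun a => if a.2 = 0 then (x a.1).re else (x a.1).im

/-- The real `2 × 2` matrix of `x ↦ z x`. -/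
def mulForm (z : ℂ) : Matrix (Fin 2) (Fin 2) ℝ := !![z.re, -z.im; z.im, z.re]

/-- The real `2 × 2` matrix of `x ↦ z (conj x)`. -/
def conjForm (z : ℂ) : Matrix (Fin 2) (Fin 2) ℝ := !![z.re, z.im; z.im, -z.re]

/-- The commutation matrix: `commMat n *ᵥ vec X = vec Xᵀ`. -/
def commMat (n : ℕ) : Matrix (Fin n × Fin n) (Fin n × Fin n) ℂ :=
  fun p q => if q = p.swap then 1 else 0

namespace PeriodicSystem

variable {r n : ℕ} (S : PeriodicSystem r n)

/-- The part of the coefficient matrix that multiplies `vec X_1, …, vec X_r`: the blocks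
`B_kᵀ ⊗ A_k` in position `(k, k)` and `-(D_kᵀ ⊗ C_k)` in position `(k, k + 1)`, `k < r`. -/
def plainPart : Matrix (Idx r n) (Idx r n) ℂ := fun a b =>
  (if b.1 = a.1 then ((S.B a.1).transpose ⊗ₖ S.A a.1) a.2 b.2 else 0) +
  (if b.1.val = a.1.val + 1 then -((S.D a.1).transpose ⊗ₖ S.C a.1) a.2 b.2 else 0)

/-- The part that multiplies the entries of `X_1` (for `⋆ = ⊤`) or their conjugates (for `⋆ = H`)
in the last equation: the block `-(D_rᵀ ⊗ C_r) P` in position `(r, 1)`. -/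
def wrapPart : Matrix (Idx r n) (Idx r n) ℂ := fun a b =>
  if a.1.val + 1 = r ∧ b.1.val = 0 then
    -(((S.D a.1).transpose ⊗ₖ S.C a.1) * commMat n) a.2 b.2 else 0

/-- The complex coefficient matrix, of order `r n²`, of the vectorized system for `⋆ = ⊤`. -/
def matT : Matrix (Idx r n) (Idx r n) ℂ := S.plainPart + S.wrapPart

/-- The real coefficient matrix, of order `2 r n²`, of the vectorized system for `⋆ = H`. -/
def matH : Matrix (Idx r n × Fin 2) (Idx r n × Fin 2) ℝ := fun a b =>
  mulForm (S.plainPart a.1 b.1) a.2 b.2 + conjForm (S.wrapPart a.1 b.1) a.2 b.2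

end PeriodicSystem

section Norms

open scoped Matrix.Norms.L2Operator

/-- The spectral norm of a matrix. -/
def norm2 {𝕜 ι : Type} [RCLike 𝕜] [Fintype ι] [DecidableEq ι] (M : Matrix ι ι 𝕜) : ℝ := ‖M‖

end Norms

/-- The Euclidean norm of a vector. -/
def vecNorm2 {𝕜 ι : Type} [RCLike 𝕜] [Fintype ι] (x : ι → 𝕜) : ℝ := ‖WithLp.toLp 2 x‖

/-! ## The algorithm -/

section Algorithm

variable {u : ℝ} (flR : FloatArith ℝ u) (flC : FloatArith ℂ u)

/-- The cyclic bidiagonal matrix with diagonal `α` and entries `β` in positions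
`(1, 2), …, (ℓ - 1, ℓ), (ℓ, 1)`; for `ℓ = 1` the two coefficients are added. -/
def smallT {ℓ : ℕ} (α β : Fin ℓ → ℂ) : Matrix (Fin ℓ) (Fin ℓ) ℂ := fun p q =>
  if ℓ = 1 then flC.add (α p) (β p)
  else if q = p then α p
  else if q.val = (p.val + 1) % ℓ then β p
  else 0

/-- The same for `⋆ = H`, as a real matrix with `2 × 2` blocks; the unknown multiplied by `β p` is
conjugated if equation `p` is the last one (`k = r`) of the periodic system. -/
def smallH (r : ℕ) {ℓ : ℕ} (α β : Fin ℓ → ℂ) : Matrix (Fin (ℓ * 2)) (Fin (ℓ * 2)) ℝ := fun P Q =>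
  let p := (finProdFinEquiv.symm P).1
  let a := (finProdFinEquiv.symm P).2
  let q := (finProdFinEquiv.symm Q).1
  let b := (finProdFinEquiv.symm Q).2
  let diagBlock := mulForm (α p)
  let nextBlock := if r ∣ p.val + 1 then conjForm (β p) else mulForm (β p)
  if ℓ = 1 then flR.add (diagBlock a b) (nextBlock a b)
  else if q = p then diagBlock a b
  else if q.val = (p.val + 1) % ℓ then nextBlock a b
  else 0

/-- The Givens-QR solution of a small system with coefficients `α`, `β` and right-hand side `y`;
for `⋆ = H` it is carried out in real arithmetic on real and imaginary parts. -/
def smallSolve (st : StarKind) (r : ℕ) {ℓ : ℕ} (α β y : Fin ℓ → ℂ) : Fin ℓ → ℂ :=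
  match st with
  | .T => flC.cyclicSolve 1 (smallT flC α β) y
  | .H =>
    let z := flR.cyclicSolve 2 (smallH flR r α β)
      (fun P => realStack y (finProdFinEquiv.symm P))
    fun p => ⟨z (finProdFinEquiv (p, 0)), z (finProdFinEquiv (p, 1))⟩

/-- All pivots of the computed triangular factor of a small system are nonzero. -/
def SmallPivots (st : StarKind) (r : ℕ) {ℓ : ℕ} (α β : Fin ℓ → ℂ) : Prop :=
  match st with
  | .T => ∀ p, flC.cyclicFactor 1 (smallT flC α β) p p ≠ 0
  | .H => ∀ P, flR.cyclicFactor 2 (smallH flR r α β) P P ≠ 0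

/-- The variables of the algorithm: the solution `X_k` and the stored products `X_k B_k` and
`X_{k+1} D_k`. -/
structure State (r n : ℕ) where
  X : Fin r → Matrix (Fin n) (Fin n) ℂ
  XB : Fin r → Matrix (Fin n) (Fin n) ℂ
  XD : Fin r → Matrix (Fin n) (Fin n) ℂ

variable {r n : ℕ} (st : StarKind) (S : PeriodicSystem r n)

/-- The computed coefficient `(A_k)_{ii} (B_k)_{jj}` of a small system. -/
def coefA (i j : Fin n) (k : Fin r) : ℂ := flC.mul (S.A k i i) (S.B k j j)

/-- The computed coefficient `-(C_k)_{ii} (D_k)_{jj}` of a small system. -/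
def coefC (i j : Fin n) (k : Fin r) : ℂ := -flC.mul (S.C k i i) (S.D k j j)

/-- The computed `v_{ijk}`: the terms of equation `(i, j, k)` that contain known unknowns. Scalar
products run over complete rows and columns; what is not known yet is stored as zero. -/
def computeW (s : State r n) (i j : Fin n) (k : Fin r) : ℂ :=
  let f₁ := flC.add (flC.mul (S.A k i i) (flC.dot (fun t => s.X k i t) (fun t => S.B k t j)))
    (flC.dot (fun t => S.A k i t) (fun t => s.XB k t j))
  let f₂ := flC.add
    (flC.mul (S.C k i i) (flC.dot (fun t => nextX st s.X k i t) (fun t => S.D k t j)))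
    (flC.dot (fun t => S.C k i t) (fun t => s.XD k t j))
  flC.sub f₁ f₂

/-- The computed right-hand side `(E_k)_{ij} - v_{ijk}`. -/
def smallRhs (s : State r n) (i j : Fin n) (k : Fin r) : ℂ :=
  flC.sub (S.E k i j) (computeW flC st S s i j k)

/-- The computed entries `(i, j)` and `(j, i)` of `X_1, …, X_r`. For `i ≠ j` the unknowns of the
small system are `(X_1)_{ij}, …, (X_r)_{ij}, (X_1)_{ji}, …, (X_r)_{ji}`. -/
def solveBlock (s : State r n) (i j : Fin n) : (Fin r → ℂ) × (Fin r → ℂ) :=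
  if i = j then
    let x := smallSolve flR flC st r (coefA flC S i i) (coefC flC S i i)
      (smallRhs flC st S s i i)
    (x, x)
  else
    let x := smallSolve flR flC st r
      (Fin.append (coefA flC S i j) (coefA flC S j i))
      (Fin.append (coefC flC S i j) (coefC flC S j i))
      (Fin.append (smallRhs flC st S s i j) (smallRhs flC st S s j i))
    (fun k => x (Fin.castAdd r k), fun k => x (Fin.natAdd r k))

/-- One step of the block back substitution: solve the small system of `(i, j)`, store the
solution, and then update the entries `(i, j)` and `(j, i)` of the stored products. -/
def step (s : State r n) (ij : Fin n × Fin n) : State r n :=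
  let i := ij.1
  let j := ij.2
  let x := solveBlock flR flC st S s i j
  let X : Fin r → Matrix (Fin n) (Fin n) ℂ := fun k a b =>
    if a = i ∧ b = j then x.1 k else if a = j ∧ b = i then x.2 k else s.X k a b
  { X := X
    XB := fun k a b =>
      if (a = i ∧ b = j) ∨ (a = j ∧ b = i) then
        flC.dot (fun t => X k a t) (fun t => S.B k t b)
      else s.XB k a b
    XD := fun k a b =>
      if (a = i ∧ b = j) ∨ (a = j ∧ b = i) then
        flC.dot (fun t => nextX st X k a t) (fun t => S.D k t b)
      else s.XD k a b }

/-- The pairs `(1,1), (2,1), (2,2), (3,1), …, (n,n)` in lexicographic order. -/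
def blockList (n : ℕ) : List (Fin n × Fin n) :=
  (List.finRange n).flatMap fun i =>
    ((List.finRange n).filter (fun j => j ≤ i)).map fun j => (i, j)

/-- The output `X̃_1, …, X̃_r` of the algorithm: block back substitution, in the reverse of the
order of `blockList`, from zero initial values. -/
def computedX : Fin r → Matrix (Fin n) (Fin n) ℂ :=
  ((blockList n).reverse.foldl (step flR flC st S)
    { X := fun _ => 0, XB := fun _ => 0, XD := fun _ => 0 }).X

/-- The algorithm runs to completion: it never divides by a zero pivot. -/
def NoBreakdown : Prop :=
  (∀ i : Fin n, SmallPivots flR flC st r (coefA flC S i i) (coefC flC S i i)) ∧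
  ∀ i j : Fin n, j < i → SmallPivots flR flC st r
    (Fin.append (coefA flC S i j) (coefA flC S j i))
    (Fin.append (coefC flC S i j) (coefC flC S j i))

end Algorithm

/-- The relative bound `r γ_r + γ_{n²} (1 + r γ_r)`. -/
def matBound (c u : ℝ) (r n : ℕ) : ℝ :=
  r * gam c u r + gam c u (n ^ 2) * (1 + r * gam c u r)

/-- `x` solves a perturbation `(M + δM) x = e + δe` of `M x = e` with `‖δM‖₂ ≤ ε μ` and
`‖δe‖₂ ≤ η ‖e‖₂`. -/
def HasBackwardError {𝕜 ι : Type} [RCLike 𝕜] [Fintype ι] [DecidableEq ι]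
    (M : Matrix ι ι 𝕜) (e x : ι → 𝕜) (μ ε η : ℝ) : Prop :=
  ∃ (δM : Matrix ι ι 𝕜) (δe : ι → 𝕜),
    (M + δM).mulVec x = e + δe ∧ norm2 δM ≤ ε * μ ∧ vecNorm2 δe ≤ η * vecNorm2 e

/-- The reference size of the perturbation of the coefficient matrix `M`: it is `‖M‖₂`, except that
for `r = 1`, where the two terms of the only equation contain the same unknown and can cancel
in `M`, it is `‖B_1ᵀ ⊗ A_1‖₂ + ‖D_1ᵀ ⊗ C_1‖₂`. -/
def refSize {𝕜 ι : Type} [RCLike 𝕜] [Fintype ι] [DecidableEq ι] {r n : ℕ}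
    (S : PeriodicSystem r n) (M : Matrix ι ι 𝕜) : ℝ :=
  if h : r = 1 then
    let k : Fin r := ⟨0, by omega⟩
    norm2 ((S.B k).transpose ⊗ₖ S.A k) + norm2 ((S.D k).transpose ⊗ₖ S.C k)
  else norm2 M

end StarSylvester

end

/-! A normwise backward error is only a statement about the residual. If `‖e - M x‖ ≤ ε μ ‖x‖ + η
‖e‖`, the residual splits in proportion to the two terms on the right; one share is absorbed by the
rank one matrix `ρ₁ xᴴ / ‖x‖²`, the other by the right-hand side (`hasBackwardError_of_residual`).
No perturbation has to be carried through the algorithm: it suffices to insert the computed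
solution, as a fixed vector, into the system.

The residual of the scalar equation `(i, j, k)` has two main sources (`entry_residual`). The first
is the computed right-hand side of the small system. By triangularity it consists, up to rounding,
of exactly the terms of `(A_k X_k B_k)_{ij}` and `(C_k X_{k+1} D_k)_{ij}` without the current
unknowns, so its error is `O(n u)` times the entry of `|E_k| + |A_k| |X_k| |B_k| + |C_k| |X_{k+1}|
|D_k|` (`approx_side`, `approx_smallRhs`). This needs the fact that stored products, although formed
when only part of a row was known, agree with products of the final matrices up to rounding, because
the missing entries meet zeros of `B_k` or `D_k` (`finalState_XB`, `finalState_XD`). The second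
source is the Givens solver, whose residual is `O(r u)` times the coefficient size times the sum of
the moduli of the unknowns (`cyclicSolve_residual`, `stage_residual`). The rounding of the small
coefficients is of lower size and is absorbed.

For the solver, a Givens step is an isometry up to a relative error in each column. With `x` fixed,
both the residual and the quantity `‖y‖ + ∑ |x_j| ‖R e_j‖` are therefore nearly preserved
(`givens_weight`); back substitution adds a residual of the same kind, and `‖y‖` is finally
eliminated.

Passing to Euclidean norms costs one more factor `n` and `r` (`residual_le`). A block such as `B_kᵀ
⊗ A_k` has `n²` columns of norm at most `μ`, hence Frobenius norm at most `n μ`; and the sum over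
`k` in the second term costs a factor `r` by Cauchy-Schwarz. The column bound holds with `μ = ‖M‖₂`
for `r ≠ 1` because the blocks then occupy disjoint positions of `M` (`colBound_of_matT`). The
result is `O(n² u + r² u)`, which `γ_{n²}` and `r γ_r` dominate. -/

namespace StarSylvester

/-! ## Relative error calculus -/

/-- `s'` approximates `s`, where `S` bounds the size of `s`, with the relative error
`(1 + u) ^ k - 1` of `k` rounding operations. -/
def Approx {𝕜 : Type} [RCLike 𝕜] (u : ℝ) (k : ℕ) (s : 𝕜) (S : ℝ) (s' : 𝕜) : Prop :=
  ‖s‖ ≤ S ∧ ‖s' - s‖ ≤ ((1 + u) ^ k - 1) * S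

section Approx

variable {𝕜 : Type} [RCLike 𝕜] {u : ℝ}

theorem Rounds.norm_sub_le {x y : 𝕜} (h : Rounds u x y) : ‖y - x‖ ≤ u * ‖x‖ := by
  obtain ⟨δ, hδ, rfl⟩ := h
  have : x * (1 + δ) - x = δ * x := by ring
  rw [this, norm_mul]
  gcongr

theorem Rounds.norm_le {x y : 𝕜} (h : Rounds u x y) : ‖y‖ ≤ (1 + u) * ‖x‖ := by
  have h1 := h.norm_sub_le
  have h2 := norm_le_norm_add_norm_sub' y x
  linarith

theorem Rounds.eq_zero {y : 𝕜} (h : Rounds u 0 y) : y = 0 := by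
  obtain ⟨δ, -, rfl⟩ := h
  simp

theorem Approx.nonneg {k : ℕ} {s s' : 𝕜} {S : ℝ} (h : Approx u k s S s') : 0 ≤ S :=
  (norm_nonneg s).trans h.1

theorem Approx.norm_le {k : ℕ} {s s' : 𝕜} {S : ℝ} (h : Approx u k s S s') :
    ‖s'‖ ≤ (1 + u) ^ k * S := by
  have h2 := norm_le_norm_add_norm_sub' s' s
  linarith [h.1, h.2]

theorem Approx.refl (s : 𝕜) : Approx u 0 s ‖s‖ s := by simp [Approx]

theorem Approx.mono (hu : 0 ≤ u) {k l : ℕ} (hkl : k ≤ l) {s s' : 𝕜} {S T : ℝ} (hST : S ≤ T)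
    (h : Approx u k s S s') : Approx u l s T s' := by
  refine ⟨h.1.trans hST, h.2.trans ?_⟩
  have h1 : (1 + u) ^ k ≤ (1 + u) ^ l := pow_le_pow_right₀ (by linarith) hkl
  have h2 : 1 ≤ (1 + u) ^ l := one_le_pow₀ (by linarith)
  exact mul_le_mul (by linarith) hST h.nonneg (by linarith)

/-- The form `(1 + u) ^ k - 1` is chosen because it reproduces itself: `u (1 + u) ^ k + (1 + u) ^ k
- 1 = (1 + u) ^ (k + 1) - 1`. -/
theorem Approx.round (hu : 0 ≤ u) {k : ℕ} {s s' y : 𝕜} {S : ℝ} (h : Approx u k s S s')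
    (hy : Rounds u s' y) : Approx u (k + 1) s S y := by
  refine ⟨h.1, ?_⟩
  have h1 := norm_sub_le_norm_sub_add_norm_sub y s' s
  have h2 := hy.norm_sub_le
  have h3 := h.2
  have h4 := mul_le_mul_of_nonneg_left h.norm_le hu
  calc ‖y - s‖ ≤ u * ((1 + u) ^ k * S) + ((1 + u) ^ k - 1) * S := by linarith
    _ = _ := by ring

theorem Approx.exact_add {k : ℕ} {s s' t t' : 𝕜} {S T : ℝ}
    (hs : Approx u k s S s') (ht : Approx u k t T t') : Approx u k (s + t) (S + T) (s' + t') := by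
  refine ⟨(norm_add_le _ _).trans (add_le_add hs.1 ht.1), ?_⟩
  rw [add_sub_add_comm]
  refine (norm_add_le _ _).trans ?_
  rw [mul_add]
  exact add_le_add hs.2 ht.2

theorem Approx.neg {k : ℕ} {s s' : 𝕜} {S : ℝ} (hs : Approx u k s S s') :
    Approx u k (-s) S (-s') := by
  refine ⟨by simpa using hs.1, ?_⟩
  rw [neg_sub_neg, norm_sub_rev]
  exact hs.2

theorem Approx.exact_sub {k : ℕ} {s s' t t' : 𝕜} {S T : ℝ}
    (hs : Approx u k s S s') (ht : Approx u k t T t') : Approx u k (s - t) (S + T) (s' - t') := by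
  simpa only [sub_eq_add_neg] using hs.exact_add ht.neg

theorem Approx.exact_mul (hu : 0 ≤ u) {k l : ℕ} {s s' t t' : 𝕜} {S T : ℝ}
    (hs : Approx u k s S s') (ht : Approx u l t T t') :
    Approx u (k + l) (s * t) (S * T) (s' * t') := by
  refine ⟨by rw [norm_mul]; exact mul_le_mul hs.1 ht.1 (norm_nonneg _) hs.nonneg, ?_⟩
  have h1 : s' * t' - s * t = (s' - s) * t' + s * (t' - t) := by ring
  have hk : 1 ≤ (1 + u) ^ k := one_le_pow₀ (by linarith)
  rw [h1]
  refine (norm_add_le _ _).trans ?_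
  rw [norm_mul, norm_mul]
  have h2 := mul_le_mul hs.2 ht.norm_le (norm_nonneg _)
    (mul_nonneg (by linarith) hs.nonneg)
  have h3 := mul_le_mul hs.1 ht.2 (norm_nonneg _) hs.nonneg
  calc _ ≤ _ := add_le_add h2 h3
    _ = _ := by ring

theorem Approx.star {k : ℕ} {s s' : 𝕜} {S : ℝ} (hs : Approx u k s S s') :
    Approx u k (star s) S (star s') := by
  refine ⟨by simpa using hs.1, ?_⟩
  rw [← star_sub, norm_star]
  exact hs.2

variable (fl : FloatArith 𝕜 u)

theorem Approx.add (hu : 0 ≤ u) {k : ℕ} {s s' t t' : 𝕜} {S T : ℝ}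
    (hs : Approx u k s S s') (ht : Approx u k t T t') :
    Approx u (k + 1) (s + t) (S + T) (fl.add s' t') :=
  (hs.exact_add ht).round hu (fl.add_spec _ _)

theorem Approx.sub (hu : 0 ≤ u) {k : ℕ} {s s' t t' : 𝕜} {S T : ℝ}
    (hs : Approx u k s S s') (ht : Approx u k t T t') :
    Approx u (k + 1) (s - t) (S + T) (fl.sub s' t') :=
  (hs.exact_sub ht).round hu (fl.sub_spec _ _)

theorem Approx.mul (hu : 0 ≤ u) {k l : ℕ} {s s' t t' : 𝕜} {S T : ℝ}
    (hs : Approx u k s S s') (ht : Approx u l t T t') :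
    Approx u (k + l + 1) (s * t) (S * T) (fl.mul s' t') :=
  (hs.exact_mul hu ht).round hu (fl.mul_spec _ _)

/-- All terms are charged with the longest chain of roundings, that of the initial value, which
passes through every addition. -/
theorem approx_foldl_add (hu : 0 ≤ u) {ι : Type} {k : ℕ} (f f' : ι → 𝕜) (F : ι → ℝ) (l : List ι)
    (h : ∀ t, Approx u k (f t) (F t) (f' t)) {m : ℕ} (hkm : k ≤ m) {s s' : 𝕜} {S : ℝ}
    (hs : Approx u m s S s') :
    Approx u (m + l.length) (s + (l.map f).sum) (S + (l.map F).sum)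
      (l.foldl (fun s t => fl.add s (f' t)) s') := by
  induction l generalizing m s s' S with
  | nil => simpa using hs
  | cons a l ih =>
    have h1 := ih (m := m + 1) (by omega) (hs.add fl hu ((h a).mono hu hkm le_rfl))
    simp only [List.length_cons, List.map_cons, List.sum_cons, List.foldl_cons]
    rw [← add_assoc s, ← add_assoc S, show m + (l.length + 1) = m + 1 + l.length by omega]
    exact h1

theorem approx_foldl_sub (hu : 0 ≤ u) {ι : Type} {k : ℕ} (f f' : ι → 𝕜) (F : ι → ℝ) (l : List ι)
    (h : ∀ t, Approx u k (f t) (F t) (f' t)) {m : ℕ} (hkm : k ≤ m) {s s' : 𝕜} {S : ℝ}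
    (hs : Approx u m s S s') :
    Approx u (m + l.length) (s - (l.map f).sum) (S + (l.map F).sum)
      (l.foldl (fun s t => fl.sub s (f' t)) s') := by
  induction l generalizing m s s' S with
  | nil => simpa using hs
  | cons a l ih =>
    have h1 := ih (m := m + 1) (by omega) (hs.sub fl hu ((h a).mono hu hkm le_rfl))
    simp only [List.length_cons, List.map_cons, List.sum_cons, List.foldl_cons]
    rw [← add_assoc S, ← sub_sub s, show m + (l.length + 1) = m + 1 + l.length by omega]
    exact h1

theorem sum_map_finRange {R : Type} [AddCommMonoid R] {N : ℕ} (f : Fin N → R) :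
    ((List.finRange N).map f).sum = ∑ t, f t := by
  rw [← List.ofFn_eq_map, List.sum_ofFn]

/-- The error of a computed scalar product of approximate vectors. -/
theorem approx_dot (hu : 0 ≤ u) {N k l : ℕ} {x x' y y' : Fin N → 𝕜} {X Y : Fin N → ℝ}
    (hx : ∀ t, Approx u k (x t) (X t) (x' t)) (hy : ∀ t, Approx u l (y t) (Y t) (y' t)) :
    Approx u (k + l + 1 + N) (∑ t, x t * y t) (∑ t, X t * Y t) (fl.dot x' y') := by
  -- The exact initial zero is given the rounding count of one product, so that all summands start
  -- at the same level.
  have h0 : Approx u (k + l + 1) (0 : 𝕜) 0 0 := ⟨by simp, by simp⟩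
  have h := approx_foldl_add fl hu (fun t => x t * y t) (fun t => fl.mul (x' t) (y' t))
    (fun t => X t * Y t) (List.finRange N) (fun t => (hx t).mul fl hu (hy t)) le_rfl h0
  rw [sum_map_finRange, sum_map_finRange, List.length_finRange, zero_add, zero_add] at h
  exact h

theorem one_add_pow_le {h : ℝ} (hh : 0 ≤ h) (k : ℕ) (hk : 2 * k * h ≤ 1) :
    (1 + h) ^ k ≤ 1 + 2 * k * h := by
  induction k with
  | zero => simp
  | succ k ih =>
    push_cast at hk ⊢
    have h1 := ih (by nlinarith)
    have h3 : 2 * (k : ℝ) * h ≤ 1 := by nlinarith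
    rw [pow_succ]
    nlinarith [mul_le_mul_of_nonneg_right h3 hh, mul_le_mul_of_nonneg_right h1 (by linarith : 0 ≤ 1 + h)]

theorem Approx.norm_sub_le (hu : 0 ≤ u) {k : ℕ} (hk : 2 * k * u ≤ 1) {s s' : 𝕜} {S : ℝ}
    (h : Approx u k s S s') : ‖s' - s‖ ≤ 2 * k * u * S :=
  h.2.trans (mul_le_mul_of_nonneg_right (by linarith [one_add_pow_le hu k hk]) h.nonneg)

end Approx

/-! ## The Euclidean norm -/

section VecNorm

variable {𝕜 ι : Type} [RCLike 𝕜] [Fintype ι]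

theorem vecNorm2_nonneg (x : ι → 𝕜) : 0 ≤ vecNorm2 x := norm_nonneg _

theorem vecNorm2_sq (x : ι → 𝕜) : vecNorm2 x ^ 2 = ∑ i, ‖x i‖ ^ 2 :=
  EuclideanSpace.norm_sq_eq _

theorem vecNorm2_zero : vecNorm2 (0 : ι → 𝕜) = 0 := by simp [vecNorm2]

theorem vecNorm2_add_le (x y : ι → 𝕜) : vecNorm2 (x + y) ≤ vecNorm2 x + vecNorm2 y := by
  simpa [vecNorm2] using norm_add_le (WithLp.toLp 2 x) (WithLp.toLp 2 y)

theorem vecNorm2_sub_le (x y : ι → 𝕜) : vecNorm2 (x - y) ≤ vecNorm2 x + vecNorm2 y := by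
  simpa [vecNorm2] using norm_sub_le (WithLp.toLp 2 x) (WithLp.toLp 2 y)

theorem vecNorm2_smul (a : 𝕜) (x : ι → 𝕜) : vecNorm2 (a • x) = ‖a‖ * vecNorm2 x := by
  simpa [vecNorm2] using norm_smul a (WithLp.toLp 2 x)

theorem vecNorm2_sum_le {κ : Type} (s : Finset κ) (f : κ → ι → 𝕜) :
    vecNorm2 (∑ k ∈ s, f k) ≤ ∑ k ∈ s, vecNorm2 (f k) := by
  classical
  induction s using Finset.induction_on with
  | empty => simp [vecNorm2_zero]
  | insert a s ha ih =>
    rw [Finset.sum_insert ha, Finset.sum_insert ha]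
    exact (vecNorm2_add_le _ _).trans (by linarith)

theorem norm_le_vecNorm2 (x : ι → 𝕜) (i : ι) : ‖x i‖ ≤ vecNorm2 x := by
  refine le_of_sq_le_sq ?_ (vecNorm2_nonneg x)
  rw [vecNorm2_sq]
  exact Finset.single_le_sum (f := fun i => ‖x i‖ ^ 2) (fun _ _ => sq_nonneg _) (Finset.mem_univ i)

theorem vecNorm2_le_of_sq_le {x : ι → 𝕜} {C : ℝ} (hC : 0 ≤ C) (h : ∑ i, ‖x i‖ ^ 2 ≤ C ^ 2) :
    vecNorm2 x ≤ C :=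
  le_of_sq_le_sq (by rwa [vecNorm2_sq]) hC

theorem vecNorm2_le_of_le {𝕜' : Type} [RCLike 𝕜'] {x : ι → 𝕜} {y : ι → 𝕜'}
    (h : ∀ i, ‖x i‖ ≤ ‖y i‖) : vecNorm2 x ≤ vecNorm2 y := by
  refine vecNorm2_le_of_sq_le (vecNorm2_nonneg y) ?_
  rw [vecNorm2_sq]
  gcongr with i
  exact h i

theorem vecNorm2_le_sum (x : ι → 𝕜) : vecNorm2 x ≤ ∑ i, ‖x i‖ := by
  refine vecNorm2_le_of_sq_le (Finset.sum_nonneg fun _ _ => norm_nonneg _) ?_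
  exact Finset.sum_sq_le_sq_sum_of_nonneg fun _ _ => norm_nonneg _

end VecNorm

/-! ## Givens rotations -/

section Givens

variable {𝕜 : Type} [RCLike 𝕜] {u : ℝ} (fl : FloatArith 𝕜 u) {N : ℕ}

/-- The exact image of `v` under the plane rotation `(c, s)` of the rows `p, q`. -/
def planeRotation (c s : 𝕜) (p q : Fin N) (v : Fin N → 𝕜) : Fin N → 𝕜 := fun i =>
  if i = p then c * v p + s * v q
  else if i = q then star c * v q - star s * v p
  else v i

theorem vecNorm2_planeRotation {c s : 𝕜} (h : ‖c‖ ^ 2 + ‖s‖ ^ 2 = 1) {p q : Fin N} (hpq : p ≠ q)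
    (v : Fin N → 𝕜) : vecNorm2 (planeRotation c s p q v) = vecNorm2 v := by
  have key : ∑ i, ‖planeRotation c s p q v i‖ ^ 2 = ∑ i, ‖v i‖ ^ 2 := by
    rw [← Finset.add_sum_erase _ _ (Finset.mem_univ p), ← Finset.add_sum_erase _ _ (Finset.mem_univ p),
      ← Finset.add_sum_erase _ _ (Finset.mem_erase.2 ⟨hpq.symm, Finset.mem_univ q⟩),
      ← Finset.add_sum_erase _ _ (Finset.mem_erase.2 ⟨hpq.symm, Finset.mem_univ q⟩),
      ← add_assoc, ← add_assoc]
    congr 1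
    · have h2 : ‖c * v p + s * v q‖ ^ 2 + ‖star c * v q - star s * v p‖ ^ 2
          = (‖c‖ ^ 2 + ‖s‖ ^ 2) * (‖v p‖ ^ 2 + ‖v q‖ ^ 2) := by
        -- Written as `z * star z`, the squared moduli turn the identity into a polynomial one in
        -- the entries and their conjugates.
        have e : ∀ z : 𝕜, ((‖z‖ ^ 2 : ℝ) : 𝕜) = z * star z := fun z => by
          rw [RCLike.star_def, RCLike.mul_conj]; push_cast; rfl
        apply RCLike.ofReal_injective (K := 𝕜)
        simp only [map_add, map_mul, e, star_add, star_sub, star_mul', star_star]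
        ring
      simp only [planeRotation, if_true, hpq.symm, if_false]
      rw [h2, h, one_mul]
    · refine Finset.sum_congr rfl fun i hi => ?_
      simp only [Finset.mem_erase] at hi
      simp [planeRotation, hi.1, hi.2.1]
  exact le_antisymm (vecNorm2_le_of_sq_le (vecNorm2_nonneg _) (by rw [key, vecNorm2_sq]))
    (vecNorm2_le_of_sq_le (vecNorm2_nonneg _) (by rw [← key, vecNorm2_sq]))

/-- Linearity, in the only form needed: the residual `y - R x` expanded in the columns of `R`, so
that errors can be compared column by column. -/
theorem planeRotation_residual (c s : 𝕜) (p q : Fin N) (y : Fin N → 𝕜) (r : Fin N → Fin N → 𝕜)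
    (x : Fin N → 𝕜) :
    planeRotation c s p q (y - ∑ j, x j • r j)
      = planeRotation c s p q y - ∑ j, x j • planeRotation c s p q (r j) := by
  funext i
  simp only [planeRotation, Pi.sub_apply, Finset.sum_apply, Pi.smul_apply, smul_eq_mul, mul_ite]
  split_ifs
  · rw [mul_sub, mul_sub, Finset.mul_sum, Finset.mul_sum, sub_add_sub_comm,
      ← Finset.sum_add_distrib]
    congr 1
    exact Finset.sum_congr rfl fun j _ => by ring
  · rw [mul_sub, mul_sub, Finset.mul_sum, Finset.mul_sum, sub_sub_sub_comm,
      ← Finset.sum_sub_distrib]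
    congr 1
    exact Finset.sum_congr rfl fun j _ => by ring
  · rfl

/-- The computed square root of the computed sum of squares. -/
theorem rsqrt_bounds (hu : 0 ≤ u) (hu1 : u ≤ 1) (f g : 𝕜) :
    let ρ := Real.sqrt (‖f‖ ^ 2 + ‖g‖ ^ 2)
    let ρ' := fl.rsqrt (fl.radd (fl.absSq f) (fl.absSq g))
    (1 - u) ^ 2 * ρ ≤ ρ' ∧ ρ' ≤ (1 + u) ^ 2 * ρ := by
  intro ρ ρ'
  have hR : ∀ {x y : ℝ}, 0 ≤ x → Rounds u x y → (1 - u) * x ≤ y ∧ y ≤ (1 + u) * x := by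
    intro x y hx h
    have h1 := h.norm_sub_le
    rw [Real.norm_eq_abs, Real.norm_of_nonneg hx, abs_le] at h1
    constructor <;> linarith [h1.1, h1.2]
  obtain ⟨f1, f2⟩ := hR (by positivity) (fl.absSq_spec f)
  obtain ⟨g1, g2⟩ := hR (by positivity) (fl.absSq_spec g)
  have hf0 : 0 ≤ (1 - u) * ‖f‖ ^ 2 := mul_nonneg (by linarith) (by positivity)
  have hg0 : 0 ≤ (1 - u) * ‖g‖ ^ 2 := mul_nonneg (by linarith) (by positivity)
  obtain ⟨s1, s2⟩ := hR (by linarith) (fl.radd_spec (fl.absSq f) (fl.absSq g))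
  set S := fl.radd (fl.absSq f) (fl.absSq g)
  have hS1 : (1 - u) ^ 2 * (‖f‖ ^ 2 + ‖g‖ ^ 2) ≤ S := by nlinarith
  have hS2 : S ≤ (1 + u) ^ 2 * (‖f‖ ^ 2 + ‖g‖ ^ 2) := by nlinarith
  have hS0 : 0 ≤ S := le_trans (by positivity) hS1
  have q1 : (1 - u) * ρ ≤ Real.sqrt S := by
    have := Real.sqrt_le_sqrt hS1
    rwa [Real.sqrt_mul (by positivity), Real.sqrt_sq (by linarith)] at this
  have q2 : Real.sqrt S ≤ (1 + u) * ρ := by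
    have := Real.sqrt_le_sqrt hS2
    rwa [Real.sqrt_mul (by positivity), Real.sqrt_sq (by linarith)] at this
  obtain ⟨r1, r2⟩ := hR (Real.sqrt_nonneg S) (fl.rsqrt_spec S hS0)
  constructor
  · nlinarith
  · nlinarith

/-- The inexact denominator is charged as four roundings and the division as a fifth. -/
theorem approx_div_of_bounds (hu : 0 ≤ u) (hu1 : u ≤ 1 / 100) {f : 𝕜} {ρ ρ' : ℝ} (hρ : 0 < ρ)
    (h1 : (1 - u) ^ 2 * ρ ≤ ρ') (h2 : ρ' ≤ (1 + u) ^ 2 * ρ) :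
    Approx u 5 (f / (ρ : 𝕜)) (‖f‖ / ρ) (fl.div f (ρ' : 𝕜)) := by
  have hρ' : 0 < ρ' := lt_of_lt_of_le (by have : (0:ℝ) < 1 - u := by linarith
                                          positivity) h1
  have h0 : Approx u 4 (f / (ρ : 𝕜)) (‖f‖ / ρ) (f / (ρ' : 𝕜)) := by
    refine ⟨by rw [norm_div, RCLike.norm_ofReal, abs_of_pos hρ], ?_⟩
    have e : f / (ρ' : 𝕜) - f / (ρ : 𝕜) = (f / (ρ : 𝕜)) * (((ρ - ρ') / ρ' : ℝ) : 𝕜) := by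
      have a1 : (ρ : 𝕜) ≠ 0 := by exact_mod_cast hρ.ne'
      have a2 : (ρ' : 𝕜) ≠ 0 := by exact_mod_cast hρ'.ne'
      push_cast
      field_simp
    rw [e, norm_mul, norm_div, RCLike.norm_ofReal, RCLike.norm_ofReal, abs_of_pos hρ, mul_comm]
    refine mul_le_mul_of_nonneg_right ?_ (by positivity)
    -- The relative error of `1 / ρ'` is at most `(2u + u²) / (1 - u)²`, which is below `4u` for `u
    -- ≤ 1 / 100`.
    have h4 : 4 * u ≤ (1 + u) ^ 4 - 1 := by nlinarith [pow_nonneg hu 2, pow_nonneg hu 3, pow_nonneg hu 4]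
    refine le_trans ?_ h4
    rw [abs_div, abs_of_pos hρ', div_le_iff₀ hρ', abs_le]
    constructor <;> nlinarith [mul_nonneg hu hρ.le, mul_nonneg (mul_nonneg hu hu) hρ.le]
  have a2 : (ρ' : 𝕜) ≠ 0 := by exact_mod_cast hρ'.ne'
  exact h0.round hu (fl.div_spec _ _ a2)

theorem approx_rotation (hu : 0 ≤ u) (hu1 : u ≤ 1 / 100) (f : 𝕜) {g : 𝕜} (hg : g ≠ 0) :
    ∃ c s : 𝕜, ‖c‖ ^ 2 + ‖s‖ ^ 2 = 1 ∧ star c * g - star s * f = 0 ∧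
      Approx u 5 c 1 (fl.rotation f g).1 ∧ Approx u 5 s 1 (fl.rotation f g).2 := by
  set ρ := Real.sqrt (‖f‖ ^ 2 + ‖g‖ ^ 2) with hρd
  have hpos : 0 < ‖f‖ ^ 2 + ‖g‖ ^ 2 := by
    have := norm_pos_iff.2 hg
    positivity
  have hρ : 0 < ρ := Real.sqrt_pos.2 hpos
  have hρ2 : ρ ^ 2 = ‖f‖ ^ 2 + ‖g‖ ^ 2 := Real.sq_sqrt hpos.le
  obtain ⟨h1, h2⟩ := rsqrt_bounds fl hu (by linarith) f g
  have hf1 : ‖star f‖ / ρ ≤ 1 := by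
    rw [div_le_one hρ, norm_star]
    exact le_of_sq_le_sq (by rw [hρ2]; nlinarith [sq_nonneg ‖g‖]) hρ.le
  have hg1 : ‖star g‖ / ρ ≤ 1 := by
    rw [div_le_one hρ, norm_star]
    exact le_of_sq_le_sq (by rw [hρ2]; nlinarith [sq_nonneg ‖f‖]) hρ.le
  refine ⟨star f / (ρ : 𝕜), star g / (ρ : 𝕜), ?_, ?_,
    (approx_div_of_bounds fl hu hu1 hρ h1 h2).mono hu le_rfl hf1,
    (approx_div_of_bounds fl hu hu1 hρ h1 h2).mono hu le_rfl hg1⟩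
  · rw [norm_div, norm_div, norm_star, norm_star, RCLike.norm_ofReal, abs_of_pos hρ, div_pow,
      div_pow, ← add_div, ← hρ2, div_self (by positivity)]
  · have a1 : (ρ : 𝕜) ≠ 0 := by exact_mod_cast hρ.ne'
    simp only [star_div₀, star_star]
    ring

/-- Five roundings in `c` and `s`, one product and one sum make seven; the two terms have total size
at most `2 ‖v‖`, and `2 · 7 · 2 = 28`. -/
theorem rotate_error (hu : 0 ≤ u) (hu1 : u ≤ 1 / 100) {c s : 𝕜} {cs : 𝕜 × 𝕜}
    (hc : Approx u 5 c 1 cs.1) (hs : Approx u 5 s 1 cs.2) (p q : Fin N) (v : Fin N → 𝕜) (i : Fin N) :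
    ‖fl.rotate cs p q v i - planeRotation c s p q v i‖ ≤
      if i = p ∨ i = q then 28 * u * vecNorm2 v else 0 := by
  have hv := fun i => (Approx.refl (u := u) (v i)).mono hu le_rfl (norm_le_vecNorm2 v i)
  have key : ∀ z z' : 𝕜, Approx u 7 z (1 * vecNorm2 v + 1 * vecNorm2 v) z' →
      ‖z' - z‖ ≤ 28 * u * vecNorm2 v := by
    intro z z' h
    have := h.norm_sub_le hu (by norm_num; linarith)
    norm_num at this
    linarith
  unfold FloatArith.rotate planeRotation
  by_cases hp : i = p
  · simp only [hp, if_true, true_or]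
    exact key _ _ ((hc.mul fl hu (hv p)).add fl hu (hs.mul fl hu (hv q)))
  · by_cases hq : i = q
    · simp only [hq, if_true, or_true]
      by_cases hqp : q = p
      · exact absurd (hq.trans hqp) hp
      · simp only [hqp, if_false]
        exact key _ _ ((hc.star.mul fl hu (hv q)).sub fl hu (hs.star.mul fl hu (hv p)))
    · simp [hp, hq]

theorem vecNorm2_le_of_support {p q : Fin N} {e : Fin N → 𝕜} {B : ℝ} (hB : 0 ≤ B)
    (h : ∀ i, ‖e i‖ ≤ if i = p ∨ i = q then B else 0) : vecNorm2 e ≤ 2 * B := by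
  refine (vecNorm2_le_sum e).trans ?_
  have h1 : ∀ i, ‖e i‖ ≤ (if i = p then B else 0) + (if i = q then B else 0) := by
    intro i
    refine (h i).trans ?_
    by_cases hp : i = p <;> by_cases hq : i = q <;> simp [hp, hq] <;> split_ifs <;> linarith
  refine (Finset.sum_le_sum fun i _ => h1 i).trans ?_
  rw [Finset.sum_add_distrib]
  simp
  linarith

theorem givensStep_of_eq_zero {p q : Fin N} {R : Matrix (Fin N) (Fin N) 𝕜} (h : R q p = 0) :
    fl.givensStep p q R = R := if_pos h

theorem givensStep_apply_of_ne_zero {p q : Fin N} {R : Matrix (Fin N) (Fin N) 𝕜} (h : R q p ≠ 0)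
    (i j : Fin N) : fl.givensStep p q R i j = if i = q ∧ j = p then 0
      else fl.rotate (fl.rotation (R p p) (R q p)) p q (fun i' => R i' j) i :=
  congrFun (congrFun (show fl.givensStep p q R = _ from if_neg h) i) j

/-- A Givens step is, up to a small relative error in each column, an isometry. -/
theorem givensStep_error (hu : 0 ≤ u) (hu1 : u ≤ 1 / 100) {p q : Fin N} (hpq : p ≠ q)
    (R : Matrix (Fin N) (Fin N) 𝕜) (y : Fin N → 𝕜) :
    ∃ G : (Fin N → 𝕜) → (Fin N → 𝕜), (∀ v, vecNorm2 (G v) = vecNorm2 v) ∧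
      (∀ (y : Fin N → 𝕜) (r : Fin N → Fin N → 𝕜) (x : Fin N → 𝕜),
        G (y - ∑ j, x j • r j) = G y - ∑ j, x j • G (r j)) ∧
      (∀ j, vecNorm2 ((fl.givensStep p q R).col j - G (R.col j)) ≤
        56 * u * vecNorm2 (R.col j)) ∧
      vecNorm2 (fl.givensStepRhs p q R y - G y) ≤ 56 * u * vecNorm2 y := by
  by_cases h0 : R q p = 0
  · refine ⟨id, fun _ => rfl, fun _ _ _ => rfl, fun j => ?_, ?_⟩
    · rw [givensStep_of_eq_zero fl h0, id, sub_self, vecNorm2_zero]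
      have := vecNorm2_nonneg (R.col j)
      positivity
    · rw [FloatArith.givensStepRhs, if_pos h0, id, sub_self, vecNorm2_zero]
      have := vecNorm2_nonneg y
      positivity
  · obtain ⟨c, s, h1, hz, hc, hs⟩ := approx_rotation fl hu hu1 (R p p) h0
    have key : ∀ e v : Fin N → 𝕜, (∀ i, ‖e i‖ ≤ if i = p ∨ i = q then 28 * u * vecNorm2 v else 0) →
        vecNorm2 e ≤ 56 * u * vecNorm2 v := by
      intro e v h
      have := vecNorm2_le_of_support (by have := vecNorm2_nonneg v; positivity) h
      linarith
    refine ⟨planeRotation c s p q, vecNorm2_planeRotation h1 hpq, planeRotation_residual c s p q,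
      fun j => key _ _ fun i => ?_, key _ _ fun i => ?_⟩
    · rw [Pi.sub_apply, Matrix.col_apply, givensStep_apply_of_ne_zero fl h0]
      by_cases hij : i = q ∧ j = p
      · obtain ⟨rfl, rfl⟩ := hij
        -- Storing an exact zero in the annihilated position causes no error, since the exact
        -- rotation built from the same data also annihilates it.
        have : planeRotation c s j i (R.col j) i = 0 := by
          simpa [planeRotation, hpq.symm] using hz
        rw [if_pos ⟨rfl, rfl⟩, this, sub_zero, norm_zero, if_pos (Or.inr rfl)]
        have := vecNorm2_nonneg (R.col j)
        positivity
      · rw [if_neg hij]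
        exact rotate_error fl hu hu1 hc hs p q (R.col j) i
    · rw [FloatArith.givensStepRhs, if_neg h0]
      exact rotate_error fl hu hu1 hc hs p q y i

/-- The total size of the terms of `y - R x`, measured by columns. -/
noncomputable def weight (R : Matrix (Fin N) (Fin N) 𝕜) (y x : Fin N → 𝕜) : ℝ :=
  vecNorm2 y + ∑ j, ‖x j‖ * vecNorm2 (R.col j)

theorem weight_nonneg (R : Matrix (Fin N) (Fin N) 𝕜) (y x : Fin N → 𝕜) : 0 ≤ weight R y x :=
  add_nonneg (vecNorm2_nonneg _)
    (Finset.sum_nonneg fun _ _ => mul_nonneg (norm_nonneg _) (vecNorm2_nonneg _))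

theorem mulVec_eq_sum_col (R : Matrix (Fin N) (Fin N) 𝕜) (x : Fin N → 𝕜) :
    R.mulVec x = ∑ j, x j • R.col j := by
  funext i
  simp [Matrix.mulVec, dotProduct, Finset.sum_apply, mul_comm]

/-- The exact isometry `G` preserves both the residual norm and every column norm, so only the
columnwise errors enter, and these add up to `56 u` times the weight. The vector `x` is arbitrary
and stays fixed. -/
theorem givensStep_weight (hu : 0 ≤ u) (hu1 : u ≤ 1 / 100) {p q : Fin N} (hpq : p ≠ q)
    (R : Matrix (Fin N) (Fin N) 𝕜) (y x : Fin N → 𝕜) :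
    weight (fl.givensStep p q R) (fl.givensStepRhs p q R y) x ≤ (1 + 56 * u) * weight R y x ∧
    vecNorm2 (y - R.mulVec x) ≤
      vecNorm2 (fl.givensStepRhs p q R y - (fl.givensStep p q R).mulVec x)
        + 56 * u * weight R y x := by
  obtain ⟨G, hG, hlin, hR, hy⟩ := givensStep_error fl hu hu1 hpq R y
  set R' := fl.givensStep p q R
  set y' := fl.givensStepRhs p q R y
  constructor
  · have h1 : ∀ v' v : Fin N → 𝕜, vecNorm2 (v' - G v) ≤ 56 * u * vecNorm2 v →
        vecNorm2 v' ≤ (1 + 56 * u) * vecNorm2 v := by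
      intro v' v h
      have := vecNorm2_add_le (v' - G v) (G v)
      rw [sub_add_cancel, hG] at this
      linarith
    unfold weight
    rw [mul_add, Finset.mul_sum]
    refine add_le_add (h1 _ _ hy) (Finset.sum_le_sum fun j _ => ?_)
    rw [mul_left_comm]
    exact mul_le_mul_of_nonneg_left (h1 _ _ (hR j)) (norm_nonneg _)
  · rw [← hG, mulVec_eq_sum_col, mulVec_eq_sum_col, hlin]
    have e : G y - ∑ j, x j • G (R.col j) = (y' - ∑ j, x j • R'.col j)
        - ((y' - G y) - ∑ j, x j • (R'.col j - G (R.col j))) := by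
      simp only [smul_sub, Finset.sum_sub_distrib]
      abel
    rw [e]
    refine (vecNorm2_sub_le _ _).trans (add_le_add le_rfl ((vecNorm2_sub_le _ _).trans ?_))
    unfold weight
    rw [mul_add, Finset.mul_sum]
    refine add_le_add hy ((vecNorm2_sum_le _ _).trans (Finset.sum_le_sum fun j _ => ?_))
    rw [vecNorm2_smul, mul_left_comm]
    exact mul_le_mul_of_nonneg_left (hR j) (norm_nonneg _)

theorem givens_weight (hu : 0 ≤ u) (hu1 : u ≤ 1 / 100) (l : List (Fin N × Fin N))
    (hl : ∀ pq ∈ l, pq.1 ≠ pq.2) (R : Matrix (Fin N) (Fin N) 𝕜) (y x : Fin N → 𝕜) :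
    weight (fl.givensFactor l R) (fl.givensRhs l R y) x ≤
      (1 + 56 * u) ^ l.length * weight R y x ∧
    vecNorm2 (y - R.mulVec x) ≤
      vecNorm2 (fl.givensRhs l R y - (fl.givensFactor l R).mulVec x)
        + ((1 + 56 * u) ^ l.length - 1) * weight R y x := by
  induction l generalizing R y with
  | nil => simp [FloatArith.givensFactor, FloatArith.givensRhs]
  | cons pq l ih =>
    obtain ⟨p, q⟩ := pq
    obtain ⟨h1, h2⟩ := givensStep_weight fl hu hu1 (hl (p, q) (by simp)) R y x
    obtain ⟨h3, h4⟩ := ih (fun pq h => hl pq (List.mem_cons_of_mem _ h))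
      (fl.givensStep p q R) (fl.givensStepRhs p q R y)
    simp only [FloatArith.givensFactor, FloatArith.givensRhs, List.length_cons, pow_succ]
    have hk : 1 ≤ (1 + 56 * u) ^ l.length := one_le_pow₀ (by linarith)
    constructor
    · refine h3.trans ?_
      rw [mul_assoc]
      exact mul_le_mul_of_nonneg_left h1 (by linarith)
    · have h5 := mul_le_mul_of_nonneg_left h1 (sub_nonneg.2 hk)
      linarith

end Givens

/-! ### Triangular form of the computed Givens factor -/

section Triangular

variable {𝕜 : Type} [RCLike 𝕜] {u : ℝ} (fl : FloatArith 𝕜 u) {N : ℕ}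

/-- Purely relative errors leave exact zeros intact; this is why the zero pattern survives rounding.
-/
theorem FloatArith.mul_zero' (x : 𝕜) : fl.mul x 0 = 0 :=
  Rounds.eq_zero (by simpa using fl.mul_spec x 0)

theorem FloatArith.add_zero_zero : fl.add (0 : 𝕜) 0 = 0 :=
  Rounds.eq_zero (by simpa using fl.add_spec 0 0)

theorem FloatArith.sub_zero_zero : fl.sub (0 : 𝕜) 0 = 0 :=
  Rounds.eq_zero (by simpa using fl.sub_spec 0 0)

theorem givensStep_annihilates (p q : Fin N) (R : Matrix (Fin N) (Fin N) 𝕜) :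
    fl.givensStep p q R q p = 0 := by
  by_cases h : R q p = 0
  · rw [givensStep_of_eq_zero fl h, h]
  · rw [givensStep_apply_of_ne_zero fl h, if_pos ⟨rfl, rfl⟩]

theorem givensStep_row_of_ne {p q i : Fin N} (hp : i ≠ p) (hq : i ≠ q)
    (R : Matrix (Fin N) (Fin N) 𝕜) (j : Fin N) : fl.givensStep p q R i j = R i j := by
  by_cases h : R q p = 0
  · rw [givensStep_of_eq_zero fl h]
  · rw [givensStep_apply_of_ne_zero fl h, if_neg (fun h => hq h.1), FloatArith.rotate, if_neg hp,
      if_neg hq]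

theorem givensStep_eq_zero {p q i j : Fin N} {R : Matrix (Fin N) (Fin N) 𝕜} (h : R i j = 0)
    (hp : R p j = 0) (hq : R q j = 0) : fl.givensStep p q R i j = 0 := by
  by_cases h0 : R q p = 0
  · rw [givensStep_of_eq_zero fl h0, h]
  · rw [givensStep_apply_of_ne_zero fl h0, FloatArith.rotate]
    simp only [hp, hq, h, fl.mul_zero', fl.add_zero_zero, fl.sub_zero_zero, ite_self]

/-- The zero pattern of a block cyclic bidiagonal matrix after elimination of the columns
before `m`. -/
def CyclicPattern (b m : ℕ) (R : Matrix (Fin N) (Fin N) 𝕜) : Prop :=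
  (∀ i j : Fin N, j.val < m → j < i → R i j = 0) ∧
  ∀ i j : Fin N, i.val + b < N → j.val / b < i.val / b → R i j = 0

/-- A position stays zero if both rotated rows vanish in its column. In a column before `p` both
rows are already eliminated. If row `q` lies outside the last block, it shares the block of `p`, so
both rows vanish to the left of that block. -/
theorem CyclicPattern.givensStep {b : ℕ} {p q : Fin N} {R : Matrix (Fin N) (Fin N) 𝕜}
    (h : CyclicPattern b p R) (hpq : p < q) (hq : q.val / b = p.val / b ∨ N ≤ q.val + b) :
    CyclicPattern b p (fl.givensStep p q R) := by
  constructor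
  · intro i j hj hji
    exact givensStep_eq_zero fl (h.1 i j hj hji) (h.1 p j hj hj) (h.1 q j hj (hj.trans hpq))
  · intro i j hi hji
    have h0 := h.2 i j hi hji
    by_cases hip : i = p
    · subst hip
      have hj : j < i := by
        by_contra hc
        exact absurd (Nat.div_le_div_right (c := b) (not_lt.1 hc)) (by simpa using hji)
      exact givensStep_eq_zero fl h0 h0 (h.1 q j hj (hj.trans hpq))
    · by_cases hiq : i = q
      · subst hiq
        have hb : i.val / b = p.val / b := hq.resolve_right (by omega)
        have hpi : p.val < i.val := hpq
        exact givensStep_eq_zero fl h0 (h.2 p j (by omega) (hb ▸ hji)) h0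
      · rw [givensStep_row_of_ne fl hip hiq, h0]

theorem givensFactor_append (l l' : List (Fin N × Fin N)) (R : Matrix (Fin N) (Fin N) 𝕜) :
    fl.givensFactor (l ++ l') R = fl.givensFactor l' (fl.givensFactor l R) := by
  induction l generalizing R with
  | nil => rfl
  | cons a l ih => exact ih _

/-- Zeros of column `p` persist because each rotation of this column changes, apart from row `p`,
only the row that it annihilates. -/
theorem CyclicPattern.givensFactor_column {b : ℕ} {p : Fin N} (l : List (Fin N))
    (hl : ∀ q ∈ l, p < q ∧ (q.val / b = p.val / b ∨ N ≤ q.val + b))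
    {R : Matrix (Fin N) (Fin N) 𝕜} (h : CyclicPattern b p R) :
    CyclicPattern b p (fl.givensFactor (l.map fun q => (p, q)) R) ∧
    (∀ i, i ≠ p → R i p = 0 → fl.givensFactor (l.map fun q => (p, q)) R i p = 0) ∧
    ∀ q ∈ l, fl.givensFactor (l.map fun q => (p, q)) R q p = 0 := by
  induction l generalizing R with
  | nil => exact ⟨h, fun i _ hi => hi, by simp⟩
  | cons a l ih =>
    have ha := hl a (by simp)
    obtain ⟨h1, h2, h3⟩ := ih (fun q hq => hl q (List.mem_cons_of_mem _ hq))
      (h.givensStep fl ha.1 ha.2)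
    simp only [List.map_cons, FloatArith.givensFactor]
    refine ⟨h1, fun i hi h0 => h2 i hi ?_, fun q hq => ?_⟩
    · by_cases hia : i = a
      · rw [hia, givensStep_annihilates]
      · rw [givensStep_row_of_ne fl hi hia, h0]
    · rcases List.mem_cons.1 hq with rfl | hq
      · exact h2 _ ha.1.ne' (givensStep_annihilates fl _ _ _)
      · exact h3 q hq

/-- Induction on the number `k` of columns left. Entries below the diagonal of the current column
are either annihilated by a listed rotation or, outside its block and the last one, zero by the
block pattern. -/
theorem CyclicPattern.givensFactor_drop {b : ℕ} (k m : ℕ) (hk : m + k = N)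
    {R : Matrix (Fin N) (Fin N) 𝕜} (h : CyclicPattern b m R) :
    CyclicPattern b N (fl.givensFactor (((List.finRange N).drop m).flatMap fun p =>
      ((List.finRange N).filter
        (fun q => p < q ∧ (q.val / b = p.val / b ∨ N ≤ q.val + b))).map fun q => (p, q)) R) := by
  induction k generalizing m R with
  | zero =>
    obtain rfl : m = N := by omega
    rw [List.drop_eq_nil_of_le (by simp)]
    exact h
  | succ k ih =>
    have hm : m < (List.finRange N).length := by simp; omega
    rw [List.drop_eq_getElem_cons hm, List.flatMap_cons, givensFactor_append]
    refine ih (m + 1) (by omega) ?_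
    set p : Fin N := (List.finRange N)[m] with hp
    have hpm : p.val = m := by simp [hp]
    rw [← hpm] at h
    obtain ⟨h1, h2, h3⟩ := h.givensFactor_column fl ((List.finRange N).filter
        (fun q => p < q ∧ (q.val / b = p.val / b ∨ N ≤ q.val + b))) (by simp)
    refine ⟨fun i j hj hji => ?_, h1.2⟩
    by_cases hjp : j.val < p.val
    · exact h1.1 i j hjp hji
    · rw [show j = p from Fin.ext (by omega)] at hji ⊢
      by_cases hi : i.val / b = p.val / b ∨ N ≤ i.val + b
      · exact h3 i (by simp [hji, hi])
      · push Not at hi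
        exact h2 i hji.ne' (h.2 i p hi.2
          (lt_of_le_of_ne (Nat.div_le_div_right (Fin.lt_def.1 hji).le) hi.1.symm))

/-- The Givens-QR factor of a block cyclic bidiagonal matrix is upper triangular. -/
theorem cyclicFactor_eq_zero {b : ℕ} {M : Matrix (Fin N) (Fin N) 𝕜}
    (h : ∀ i j : Fin N, i.val + b < N → j.val / b < i.val / b → M i j = 0)
    {i j : Fin N} (hji : j < i) : fl.cyclicFactor b M i j = 0 := by
  have h0 : CyclicPattern b 0 M := ⟨by simp, h⟩
  exact (h0.givensFactor_drop fl N 0 (by simp)).1 i j j.2 hji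

/-- Each pivot row `p` meets at most `b` rows of its own block and `b` rows of the last one. A count
linear in `N` is what keeps the solver error at `O(r u)`. -/
theorem length_rotationList_le {b : ℕ} (hb : 0 < b) : (rotationList N b).length ≤ 2 * b * N := by
  unfold rotationList
  rw [List.length_flatMap]
  refine (List.sum_le_card_nsmul _ (2 * b) ?_).trans (by simp [mul_comm])
  intro k hk
  obtain ⟨p, -, rfl⟩ := List.mem_map.1 hk
  rw [List.length_map]
  set l := (List.finRange N).filter
    (fun q => p < q ∧ (q.val / b = p.val / b ∨ N ≤ q.val + b)) with hl
  have hnd : (l.map Fin.val).Nodup :=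
    ((List.nodup_finRange N).filter _).map Fin.val_injective
  rw [← List.length_map (f := Fin.val), ← List.toFinset_card_of_nodup hnd]
  refine (Finset.card_le_card (t := Finset.Ico (p.val / b * b) (p.val / b * b + b) ∪
    Finset.Ico (N - b) N) ?_).trans ((Finset.card_union_le _ _).trans ?_)
  · intro v hv
    simp only [List.mem_toFinset, List.mem_map, hl, List.mem_filter, decide_eq_true_eq] at hv
    obtain ⟨q, ⟨-, hpq, hq⟩, rfl⟩ := hv
    have hpq' : p.val < q.val := hpq
    rw [Finset.mem_union, Finset.mem_Ico, Finset.mem_Ico]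
    rcases hq with hq | hq
    · left
      rw [← hq]
      have h1 := Nat.div_add_mod q.val b
      have h2 := Nat.mod_lt q.val hb
      rw [mul_comm b] at h1
      omega
    · right
      omega
  · simp only [Nat.card_Ico]
    omega

theorem ne_of_mem_rotationList {b : ℕ} {pq : Fin N × Fin N} (h : pq ∈ rotationList N b) :
    pq.1 ≠ pq.2 := by
  simp only [rotationList, List.mem_flatMap, List.mem_map, List.mem_filter,
    decide_eq_true_eq] at h
  obtain ⟨p, -, q, ⟨-, h, -⟩, rfl⟩ := h
  exact h.ne

end Triangular

/-! ## Back substitution -/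

section BackSubst

variable {𝕜 : Type} [RCLike 𝕜] {u : ℝ} (fl : FloatArith 𝕜 u) {N : ℕ}

theorem foldl_update_of_notMem {α : Type} {N : ℕ} (F : Fin N → (Fin N → α) → α) (l : List (Fin N))
    (x : Fin N → α) {i : Fin N} (h : i ∉ l) :
    l.foldl (fun x i => Function.update x i (F i x)) x i = x i := by
  induction l generalizing x with
  | nil => rfl
  | cons a l ih =>
    rw [List.mem_cons, not_or] at h
    rw [List.foldl_cons, ih _ h.2, Function.update_of_ne h.1]

/-- Component `i` is written once, from components of larger index that are already final; hence the
recursion holds as an equation for the final vector. -/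
theorem foldl_update_eq {α : Type} {N : ℕ} (F : Fin N → (Fin N → α) → α)
    (hF : ∀ i x y, (∀ j, i < j → x j = y j) → F i x = F i y) (l : List (Fin N))
    (hl : l.Pairwise (fun a b => b < a)) (x : Fin N → α) {i : Fin N} (h : i ∈ l) :
    l.foldl (fun x i => Function.update x i (F i x)) x i =
      F i (l.foldl (fun x i => Function.update x i (F i x)) x) := by
  induction l generalizing x with
  | nil => simp at h
  | cons a l ih =>
    rw [List.pairwise_cons] at hl
    rw [List.foldl_cons]
    by_cases hi : i ∈ l
    · exact ih hl.2 _ hi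
    · obtain rfl : i = a := (List.mem_cons.1 h).resolve_right hi
      rw [foldl_update_of_notMem F l _ hi, Function.update_self]
      refine hF _ _ _ fun j hj => ?_
      rw [foldl_update_of_notMem F l _ (fun hjl => (hl.1 j hjl).not_gt hj),
        Function.update_of_ne hj.ne']

theorem backSubst_apply (R : Matrix (Fin N) (Fin N) 𝕜) (y : Fin N → 𝕜) (i : Fin N) :
    fl.backSubst R y i = fl.div
        (((List.finRange N).filter (fun j => i < j)).foldl
          (fun s j => fl.sub s (fl.mul (R i j) (fl.backSubst R y j))) (y i))
        (R i i) := by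
  refine foldl_update_eq (fun i x => fl.div
        (((List.finRange N).filter (fun j => i < j)).foldl
          (fun s j => fl.sub s (fl.mul (R i j) (x j))) (y i))
        (R i i)) ?_ _ ?_ _ (by simp)
  · intro i x z h
    congr 1
    refine List.foldl_ext _ _ _ fun s j hj => ?_
    rw [h j (by simpa using hj)]
  · rw [List.pairwise_reverse]
    exact List.pairwise_lt_finRange N

theorem sum_map_filter_finRange {R : Type} [AddCommMonoid R] (p : Fin N → Prop) [DecidablePred p]
    (f : Fin N → R) :
    (((List.finRange N).filter p).map f).sum = ∑ j, if p j then f j else 0 := by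
  rw [← sum_map_finRange]
  induction List.finRange N with
  | nil => rfl
  | cons a l ih =>
    by_cases h : p a <;> simp [h, ih]

theorem backSubst_residual (hu : 0 ≤ u) (hN : 2 * (N + 2 : ℕ) * u ≤ 1)
    {R : Matrix (Fin N) (Fin N) 𝕜} (hR : ∀ i j, j < i → R i j = 0) (hd : ∀ i, R i i ≠ 0)
    (y : Fin N → 𝕜) :
    vecNorm2 (y - R.mulVec (fl.backSubst R y)) ≤
      2 * (N + 2 : ℕ) * u * weight R y (fl.backSubst R y) := by
  set x := fl.backSubst R y with hx
  -- The rowwise bounds `|y| + |R| |x|` are collected in one vector, whose norm is at most the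
  -- columnwise weight by the triangle inequality.
  set g : Fin N → ℝ := (fun i => ‖y i‖) + ∑ j, ‖x j‖ • fun i => ‖R i j‖ with hg
  have hgi : ∀ i, g i = ‖y i‖ + ∑ j, ‖x j‖ * ‖R i j‖ := fun i => by
    simp [hg, Finset.sum_apply]
  have hgn : vecNorm2 g ≤ weight R y x := by
    refine (vecNorm2_add_le _ _).trans (add_le_add (vecNorm2_le_of_le fun i => by simp)
      ((vecNorm2_sum_le _ _).trans (Finset.sum_le_sum fun j _ => ?_)))
    rw [vecNorm2_smul, norm_norm]
    exact mul_le_mul_of_nonneg_left (vecNorm2_le_of_le fun i => by simp [Matrix.col])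
      (norm_nonneg _)
  have hc : 0 ≤ 2 * (N + 2 : ℕ) * u := by positivity
  refine le_trans ?_ (mul_le_mul_of_nonneg_left hgn hc)
  rw [show 2 * (N + 2 : ℕ) * u * vecNorm2 g = vecNorm2 ((2 * (N + 2 : ℕ) * u) • g) by
    rw [vecNorm2_smul, Real.norm_of_nonneg hc]]
  refine vecNorm2_le_of_le fun i => ?_
  have hgi0 : 0 ≤ g i := by rw [hgi]; positivity
  rw [Pi.smul_apply, smul_eq_mul, Real.norm_of_nonneg (mul_nonneg hc hgi0)]
  have h0 := approx_foldl_sub fl hu (k := 1) (fun j => R i j * x j) (fun j => fl.mul (R i j) (x j))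
    (fun j => ‖R i j‖ * ‖x j‖) ((List.finRange N).filter (fun j => i < j))
    (fun j => (Approx.refl _).mul fl hu (Approx.refl _)) le_rfl
    ((Approx.refl (y i)).mono hu zero_le_one le_rfl)
  rw [sum_map_filter_finRange, sum_map_filter_finRange] at h0
  have hlen : ((List.finRange N).filter (fun j => i < j)).length ≤ N := by
    simpa using List.length_filter_le (fun j => decide (i < j)) (List.finRange N)
  have hS : ‖y i‖ + ∑ j, (if i < j then ‖R i j‖ * ‖x j‖ else 0) ≤ g i := by
    rw [hgi]
    gcongr with j
    split_ifs
    · rw [mul_comm]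
    · positivity
  have hr := fl.div_spec (((List.finRange N).filter (fun j => i < j)).foldl
          (fun s j => fl.sub s (fl.mul (R i j) (x j))) (y i)) (R i i) (hd i)
  rw [hx, ← backSubst_apply, ← hx] at hr
  -- The relative error of the division is moved to the product `R i i * x i`. This quantity then
  -- carries at most `N + 2` roundings: one product, up to `N` subtractions, one division.
  have hr' : Rounds u (((List.finRange N).filter (fun j => i < j)).foldl
          (fun s j => fl.sub s (fl.mul (R i j) (x j))) (y i)) (R i i * x i) := by
    obtain ⟨δ, hδ, he⟩ := hr
    refine ⟨δ, hδ, ?_⟩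
    rw [he]
    field_simp [hd i]
  have h1 := ((h0.mono hu (show _ ≤ N + 1 by omega) hS).round hu hr').norm_sub_le hu hN
  have e : (y - R.mulVec x) i =
      -(R i i * x i - (y i - ∑ j, if i < j then R i j * x j else 0)) := by
    have : R.mulVec x i = R i i * x i + ∑ j, if i < j then R i j * x j else 0 := by
      have h2 : R i i * x i = ∑ j, if j = i then R i j * x j else 0 := by simp
      rw [h2, ← Finset.sum_add_distrib, Matrix.mulVec, dotProduct]
      refine Finset.sum_congr rfl fun j _ => ?_
      rcases lt_trichotomy i j with h | h | h
      · simp [h, h.ne']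
      · simp [h]
      · simp [h.not_gt, h.ne, hR i j h]
    rw [Pi.sub_apply, this]
    ring
  rw [e, norm_neg]
  exact h1

/-- The Givens-QR solver for block cyclic bidiagonal systems is backward stable. -/
theorem cyclicSolve_residual (hu : 0 ≤ u) {b : ℕ} (hb : 0 < b)
    (hN : 2000 * ((b : ℝ) * N * u) ≤ 1)
    {M : Matrix (Fin N) (Fin N) 𝕜}
    (h : ∀ i j : Fin N, i.val + b < N → j.val / b < i.val / b → M i j = 0)
    (hd : ∀ i, fl.cyclicFactor b M i i ≠ 0) (y : Fin N → 𝕜) :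
    vecNorm2 (y - M.mulVec (fl.cyclicSolve b M y)) ≤
      1000 * ((b : ℝ) * N * u) * ∑ j, ‖fl.cyclicSolve b M y j‖ * vecNorm2 (M.col j) := by
  set x := fl.cyclicSolve b M y with hx
  set V := ∑ j, ‖x j‖ * vecNorm2 (M.col j) with hV
  rcases Nat.eq_zero_or_pos N with rfl | hNpos
  · simp [vecNorm2, hV]
  have hV0 : 0 ≤ V :=
    Finset.sum_nonneg fun _ _ => mul_nonneg (norm_nonneg _) (vecNorm2_nonneg _)
  have hb1 : (1 : ℝ) ≤ b := by exact_mod_cast hb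
  have hN1 : (1 : ℝ) ≤ N := by exact_mod_cast hNpos
  have hNu : (N : ℝ) * u ≤ b * N * u := by
    rw [mul_assoc]
    exact le_mul_of_one_le_left (by positivity) hb1
  have huN : u ≤ N * u := le_mul_of_one_le_left hu hN1
  set ε := (b : ℝ) * N * u with hε
  set l := rotationList N b with hl
  obtain ⟨h1, h2⟩ := givens_weight fl hu (by linarith) l
    (fun _ => ne_of_mem_rotationList) M y x
  have hlen : (l.length : ℝ) * u ≤ 2 * ε := by
    have : (l.length : ℝ) ≤ 2 * b * N := by exact_mod_cast length_rotationList_le hb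
    calc (l.length : ℝ) * u ≤ 2 * b * N * u := by gcongr
      _ = 2 * ε := by rw [hε]; ring
  have hp := one_add_pow_le (h := 56 * u) (by positivity) l.length (by linarith)
  have hp' : (1 + 56 * u) ^ l.length ≤ 1 + 224 * ε := by linarith
  have h3 := backSubst_residual fl hu (N := N) (by push_cast; nlinarith)
    (fun i j => cyclicFactor_eq_zero fl h (i := i) (j := j)) hd (fl.givensRhs l M y)
  change vecNorm2 (fl.givensRhs l M y - (fl.givensFactor l M).mulVec x) ≤
    _ * weight (fl.givensFactor l M) (fl.givensRhs l M y) x at h3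
  have hW0 := weight_nonneg M y x
  have hWK : weight (fl.givensFactor l M) (fl.givensRhs l M y) x ≤ 2 * weight M y x :=
    h1.trans (mul_le_mul_of_nonneg_right (by linarith) hW0)
  have h4 : vecNorm2 (fl.givensRhs l M y - (fl.givensFactor l M).mulVec x) ≤
      12 * ε * weight M y x := by
    refine h3.trans ?_
    calc 2 * ((N + 2 : ℕ) : ℝ) * u * weight (fl.givensFactor l M) (fl.givensRhs l M y) x
        ≤ 6 * ε * (2 * weight M y x) := by
          refine mul_le_mul ?_ hWK (weight_nonneg _ _ _) (by positivity)
          push_cast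
          nlinarith
      _ = _ := by ring
  -- Here `236 = 224 + 12`: the rotations contribute `2 · 56 · 2`, and back substitution `6` times
  -- the growth factor `2` of the weight.
  have h5 : vecNorm2 (y - M.mulVec x) ≤ 236 * ε * weight M y x := by
    have := mul_le_mul_of_nonneg_right (sub_le_sub_right hp' 1) hW0
    linarith
  have hMx : vecNorm2 (M.mulVec x) ≤ V := by
    rw [mulVec_eq_sum_col]
    refine (vecNorm2_sum_le _ _).trans (le_of_eq ?_)
    simp only [vecNorm2_smul, hV]
  -- The term `‖y‖` of the weight is replaced by the residual plus `V`; the residual is then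
  -- absorbed on the left because `236 ε ≤ 1 / 2`, so the right-hand side disappears from the bound.
  have hy : vecNorm2 y ≤ vecNorm2 (y - M.mulVec x) + V := by
    have := vecNorm2_add_le (y - M.mulVec x) (M.mulVec x)
    rw [sub_add_cancel] at this
    linarith
  have hε0 : 0 ≤ ε := by positivity
  have h6 : weight M y x ≤ vecNorm2 (y - M.mulVec x) + 2 * V := by
    unfold weight
    linarith
  have h7 := mul_le_mul_of_nonneg_left h6 (by positivity : 0 ≤ 236 * ε)
  have h8 : 236 * ε * vecNorm2 (y - M.mulVec x) ≤ 1 / 2 * vecNorm2 (y - M.mulVec x) :=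
    mul_le_mul_of_nonneg_right (by linarith) (vecNorm2_nonneg _)
  nlinarith [mul_nonneg hε0 hV0]

end BackSubst

/-! ## The small systems -/

/-- The effect of `⋆` on a single entry. -/
def StarKind.entry : StarKind → ℂ → ℂ
  | .T, z => z
  | .H, z => star z

theorem StarKind.norm_entry (st : StarKind) (z : ℂ) : ‖st.entry z‖ = ‖z‖ := by
  cases st
  · rfl
  · exact norm_star z

/-- The cyclic successor. -/
def cyc {ℓ : ℕ} (p : Fin ℓ) : Fin ℓ := ⟨(p.val + 1) % ℓ, Nat.mod_lt _ p.pos⟩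

theorem cyc_of_lt {ℓ : ℕ} {p : Fin ℓ} (h : p.val + 1 < ℓ) : cyc p = ⟨p.val + 1, h⟩ :=
  Fin.ext (Nat.mod_eq_of_lt h)

theorem cyc_of_eq {ℓ : ℕ} {p : Fin ℓ} (h : p.val + 1 = ℓ) : cyc p = ⟨0, p.pos⟩ :=
  Fin.ext (by simp [cyc, h])

theorem cyc_injective {ℓ : ℕ} : Function.Injective (cyc (ℓ := ℓ)) := by
  intro p q h
  have hp := p.2
  have hq := q.2
  rcases Nat.lt_or_ge (p.val + 1) ℓ with h1 | h1 <;> rcases Nat.lt_or_ge (q.val + 1) ℓ with h2 | h2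
  · rw [cyc_of_lt h1, cyc_of_lt h2] at h
    simp at h
    exact Fin.ext h
  · rw [cyc_of_lt h1, cyc_of_eq (by omega)] at h
    simp at h
  · rw [cyc_of_eq (by omega), cyc_of_lt h2] at h
    simp at h
  · exact Fin.ext (by omega)

theorem sum_cyc {R : Type} [AddCommMonoid R] {ℓ : ℕ} (f : Fin ℓ → R) :
    ∑ p, f (cyc p) = ∑ p, f p :=
  (Finite.injective_iff_bijective.1 cyc_injective).sum_comp f

theorem cyc_ne {ℓ : ℕ} (h : ℓ ≠ 1) (p : Fin ℓ) : cyc p ≠ p := by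
  have hp := p.2
  rcases Nat.lt_or_ge (p.val + 1) ℓ with h1 | h1
  · rw [cyc_of_lt h1]
    intro h
    have := congrArg Fin.val h
    simp at this
  · rw [cyc_of_eq (by omega)]
    intro h
    have := congrArg Fin.val h
    simp at this
    omega

theorem fin_eq_of_eq_one {ℓ : ℕ} (h : ℓ = 1) (p q : Fin ℓ) : p = q := by
  subst h
  exact Subsingleton.elim _ _

section SmallSystems

variable {u : ℝ} (flR : FloatArith ℝ u) (flC : FloatArith ℂ u)

theorem norm_re_add_im_le (z : ℂ) : ‖z‖ ≤ |z.re| + |z.im| := Complex.norm_le_abs_re_add_abs_im z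

theorem abs_mulForm_le (z : ℂ) (a b : Fin 2) : |mulForm z a b| ≤ ‖z‖ := by
  have h1 := Complex.abs_re_le_norm z
  have h2 := Complex.abs_im_le_norm z
  fin_cases a <;> fin_cases b <;> simpa [mulForm]

theorem abs_conjForm_le (z : ℂ) (a b : Fin 2) : |conjForm z a b| ≤ ‖z‖ := by
  have h1 := Complex.abs_re_le_norm z
  have h2 := Complex.abs_im_le_norm z
  fin_cases a <;> fin_cases b <;> simpa [conjForm]

/-- Real and imaginary part of a complex number, as a vector. -/
def reIm (z : ℂ) (a : Fin 2) : ℝ := if a = 0 then z.re else z.im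

theorem abs_reIm_le (z : ℂ) (a : Fin 2) : |reIm z a| ≤ ‖z‖ := by
  unfold reIm
  split_ifs
  · exact Complex.abs_re_le_norm z
  · exact Complex.abs_im_le_norm z

theorem sum_mulForm (z x : ℂ) (a : Fin 2) :
    ∑ b, mulForm z a b * reIm x b = reIm (z * x) a := by
  fin_cases a <;> simp [mulForm, reIm, Fin.sum_univ_two] <;> ring

theorem sum_conjForm (z x : ℂ) (a : Fin 2) :
    ∑ b, conjForm z a b * reIm x b = reIm (z * star x) a := by
  fin_cases a <;> simp [conjForm, reIm, Fin.sum_univ_two] <;> ring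

theorem smallT_residual (hu : 0 ≤ u) {ℓ : ℕ} (hℓ : 2000 * (ℓ * u) ≤ 1) {α β : Fin ℓ → ℂ} {m : ℝ}
    (hm : 0 ≤ m) (hα : ∀ p, ‖α p‖ ≤ m) (hβ : ∀ p, ‖β p‖ ≤ m)
    (hd : ∀ p, flC.cyclicFactor 1 (smallT flC α β) p p ≠ 0) (y : Fin ℓ → ℂ) (p : Fin ℓ) :
    let x := flC.cyclicSolve 1 (smallT flC α β) y
    ‖y p - (α p * x p + β p * x (cyc p))‖ ≤ 4000 * (ℓ * u) * m * ∑ q, ‖x q‖ := by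
  intro x
  set M := smallT flC α β with hM
  -- `M₀` is the exact matrix of the cyclic equations. It differs from `M` only for `ℓ = 1`, where
  -- `cyc p = p` and the two coefficients are added with rounding.
  set M₀ : Matrix (Fin ℓ) (Fin ℓ) ℂ := fun p q =>
    (if q = p then α p else 0) + (if q = cyc p then β p else 0) with hM₀
  set B : Fin ℓ → Fin ℓ → ℝ := fun p q =>
    (if q = p then m else 0) + (if q = cyc p then m else 0) with hB
  have hℓ1 : (1 : ℝ) ≤ ℓ := by exact_mod_cast p.pos
  have huℓ : u ≤ ℓ * u := le_mul_of_one_le_left hu hℓ1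
  have hB0 : ∀ p q, 0 ≤ B p q := fun p q => by simp only [hB]; split_ifs <;> linarith
  have hM₀B : ∀ p q, ‖M₀ p q‖ ≤ B p q := by
    intro p q
    refine (norm_add_le _ _).trans (add_le_add ?_ ?_) <;> (split_ifs <;> simp [hα, hβ])
  have hMB : ∀ p q, ‖M p q - M₀ p q‖ ≤ u * B p q := by
    intro p q
    by_cases h1 : ℓ = 1
    · have e1 : M p q = flC.add (α p) (β p) := by simp [hM, smallT, h1]
      have e2 : M₀ p q = α p + β p := by
        simp only [hM₀, if_pos (fin_eq_of_eq_one h1 q p), if_pos (fin_eq_of_eq_one h1 q (cyc p))]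
      rw [e1, e2]
      exact (flC.add_spec _ _).norm_sub_le.trans
        (mul_le_mul_of_nonneg_left (e2 ▸ hM₀B p q) hu)
    · have : M p q = M₀ p q := by
        by_cases hq : q = p
        · simp [hM, hM₀, smallT, h1, hq, (cyc_ne h1 p).symm]
        · have hc : q.val = (p.val + 1) % ℓ ↔ q = cyc p := by rw [Fin.ext_iff]; rfl
          simp [hM, hM₀, smallT, h1, hq, hc]
      rw [this, sub_self, norm_zero]
      exact mul_nonneg hu (hB0 p q)
  have hcol : ∀ q, vecNorm2 (M.col q) ≤ 3 * m := by
    intro q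
    refine (vecNorm2_le_sum _).trans ?_
    have h1 : ∀ p, ‖M.col q p‖ ≤ (1 + u) * B p q := fun p => by
      have := norm_le_norm_add_norm_sub' (M p q) (M₀ p q)
      have h2 := hMB p q
      have h3 := hM₀B p q
      rw [Matrix.col_apply]
      linarith
    refine (Finset.sum_le_sum fun p _ => h1 p).trans ?_
    rw [← Finset.mul_sum]
    have h2 : ∑ p, B p q = 2 * m := by
      simp only [hB]
      rw [Finset.sum_add_distrib, sum_cyc (fun p => if q = p then m else 0)]
      simp
      ring
    rw [h2]
    nlinarith
  have hres := (norm_le_vecNorm2 _ p).trans (cyclicSolve_residual flC hu one_pos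
    (by simpa [mul_assoc] using hℓ) (M := M) (by
      intro i j hi hji
      have hℓ' : ℓ ≠ 1 := by omega
      simp only [Nat.div_one] at hji
      have h1 : j ≠ i := by rintro rfl; exact lt_irrefl _ hji
      have h2 : j.val ≠ (i.val + 1) % ℓ := by
        rw [Nat.mod_eq_of_lt hi]
        omega
      simp [hM, smallT, hℓ', h1, h2]) hd y)
  have hx0 : ∀ q, ‖x q‖ ≤ ∑ q, ‖x q‖ := fun q =>
    Finset.single_le_sum (f := fun q => ‖x q‖) (fun _ _ => norm_nonneg _) (Finset.mem_univ q)
  set s := ∑ q, ‖x q‖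
  have hV : ∑ j, ‖x j‖ * vecNorm2 (M.col j) ≤ 3 * m * s := by
    rw [Finset.mul_sum]
    refine Finset.sum_le_sum fun j _ => ?_
    rw [mul_comm]
    exact mul_le_mul_of_nonneg_right (hcol j) (norm_nonneg _)
  have hM₀x : M₀.mulVec x p = α p * x p + β p * x (cyc p) := by
    simp [hM₀, Matrix.mulVec, dotProduct, add_mul, Finset.sum_add_distrib]
  have hdiff : ‖M.mulVec x p - M₀.mulVec x p‖ ≤ 2 * u * m * s := by
    rw [Matrix.mulVec, Matrix.mulVec, dotProduct, dotProduct, ← Finset.sum_sub_distrib]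
    refine (norm_sum_le _ _).trans ?_
    have h1 : ∀ q, ‖M p q * x q - M₀ p q * x q‖ ≤ u * (B p q * ‖x q‖) := fun q => by
      rw [← sub_mul, norm_mul, ← mul_assoc]
      exact mul_le_mul_of_nonneg_right (hMB p q) (norm_nonneg _)
    refine (Finset.sum_le_sum fun q _ => h1 q).trans ?_
    rw [← Finset.mul_sum]
    have h2 : ∑ q, B p q * ‖x q‖ = m * ‖x p‖ + m * ‖x (cyc p)‖ := by
      simp [hB, add_mul, Finset.sum_add_distrib]
    rw [h2]
    have := mul_le_mul_of_nonneg_left (hx0 p) hm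
    have := mul_le_mul_of_nonneg_left (hx0 (cyc p)) hm
    nlinarith
  rw [← hM₀x]
  have hs : 0 ≤ s := Finset.sum_nonneg fun _ _ => norm_nonneg _
  have h1 : ‖y p - M₀.mulVec x p‖ ≤ ‖y p - M.mulVec x p‖ + ‖M.mulVec x p - M₀.mulVec x p‖ :=
    norm_sub_le_norm_sub_add_norm_sub _ _ _
  have h2 : 1000 * (((1 : ℕ) : ℝ) * ℓ * u) * ∑ j, ‖x j‖ * vecNorm2 (M.col j) ≤
      1000 * (ℓ * u) * (3 * m * s) := by
    rw [Nat.cast_one, one_mul]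
    gcongr
  have h3 : u * (m * s) ≤ ℓ * u * (m * s) := mul_le_mul_of_nonneg_right huℓ (mul_nonneg hm hs)
  have h4 : ‖y p - M.mulVec x p‖ ≤ _ := hres.trans h2
  have h5 : 0 ≤ u * (m * s) := mul_nonneg hu (mul_nonneg hm hs)
  linarith

/-- The argument of `smallT_residual` in real coordinates: order `2ℓ` with `b = 2` gives the factor
`4ℓ`, columns have norm at most `6m`, and every unknown counts twice. Thus `1000 · 4 · 12`,
increased to `50000` by the rounding of `M`, bounds each of the two real components. -/
theorem smallH_residual (hu : 0 ≤ u) {ℓ : ℕ} (hℓ : 8000 * (ℓ * u) ≤ 1) (r : ℕ) {α β : Fin ℓ → ℂ}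
    {m : ℝ} (hm : 0 ≤ m) (hα : ∀ p, ‖α p‖ ≤ m) (hβ : ∀ p, ‖β p‖ ≤ m)
    (hd : ∀ P, flR.cyclicFactor 2 (smallH flR r α β) P P ≠ 0) (y : Fin ℓ → ℂ) (p : Fin ℓ) :
    let x := smallSolve flR flC .H r α β y
    ‖y p - (α p * x p +
      β p * (if r ∣ p.val + 1 then star (x (cyc p)) else x (cyc p)))‖ ≤
      100000 * (ℓ * u) * m * ∑ q, ‖x q‖ := by
  intro x
  set M := smallH flR r α β with hM
  set D : Fin ℓ → Fin 2 → Fin 2 → ℝ := fun p => mulForm (α p) with hD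
  set O : Fin ℓ → Fin 2 → Fin 2 → ℝ := fun p =>
    if r ∣ p.val + 1 then conjForm (β p) else mulForm (β p) with hO
  set M' : Fin ℓ → Fin 2 → Fin ℓ → Fin 2 → ℝ := fun p a q b =>
    M (finProdFinEquiv (p, a)) (finProdFinEquiv (q, b)) with hM'
  set M₀ : Fin ℓ → Fin 2 → Fin ℓ → Fin 2 → ℝ := fun p a q b =>
    (if q = p then D p a b else 0) + (if q = cyc p then O p a b else 0) with hM₀
  set B : Fin ℓ → Fin ℓ → ℝ := fun p q =>
    (if q = p then m else 0) + (if q = cyc p then m else 0) with hB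
  have hℓ1 : (1 : ℝ) ≤ ℓ := by exact_mod_cast p.pos
  have huℓ : u ≤ ℓ * u := le_mul_of_one_le_left hu hℓ1
  have hB0 : ∀ p q, 0 ≤ B p q := fun p q => by simp only [hB]; split_ifs <;> linarith
  have hOpos : ∀ p : Fin ℓ, r ∣ p.val + 1 → O p = conjForm (β p) := fun p h => if_pos h
  have hOneg : ∀ p : Fin ℓ, ¬ r ∣ p.val + 1 → O p = mulForm (β p) := fun p h => if_neg h
  have hDm : ∀ p a b, |D p a b| ≤ m := fun p a b => (abs_mulForm_le _ _ _).trans (hα p)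
  have hOm : ∀ p a b, |O p a b| ≤ m := by
    intro p a b
    by_cases h : r ∣ p.val + 1
    · rw [hOpos p h]
      exact (abs_conjForm_le _ _ _).trans (hβ p)
    · rw [hOneg p h]
      exact (abs_mulForm_le _ _ _).trans (hβ p)
  have hM₀B : ∀ p a q b, ‖M₀ p a q b‖ ≤ B p q := by
    intro p a q b
    refine (norm_add_le _ _).trans (add_le_add ?_ ?_) <;> split_ifs <;>
      simp only [Real.norm_eq_abs, abs_zero, le_refl, hDm, hOm]
  have hMval : ∀ p a q b, M' p a q b = if ℓ = 1 then flR.add (D p a b) (O p a b)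
      else if q = p then D p a b else if q.val = (p.val + 1) % ℓ then O p a b else 0 := by
    intro p a q b
    simp only [hM', hM, smallH, Equiv.symm_apply_apply, hD, hO]
    rfl
  have hMB : ∀ p a q b, ‖M' p a q b - M₀ p a q b‖ ≤ u * B p q := by
    intro p a q b
    rw [hMval]
    by_cases h1 : ℓ = 1
    · have e2 : M₀ p a q b = D p a b + O p a b := by
        simp only [hM₀, if_pos (fin_eq_of_eq_one h1 q p), if_pos (fin_eq_of_eq_one h1 q (cyc p))]
      rw [if_pos h1, e2]
      exact (flR.add_spec _ _).norm_sub_le.trans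
        (mul_le_mul_of_nonneg_left (e2 ▸ hM₀B p a q b) hu)
    · have : (if q = p then D p a b else if q.val = (p.val + 1) % ℓ then O p a b else 0) =
          M₀ p a q b := by
        by_cases hq : q = p
        · simp [hM₀, hq, (cyc_ne h1 p).symm]
        · have hc : q.val = (p.val + 1) % ℓ ↔ q = cyc p := by rw [Fin.ext_iff]; rfl
          simp only [hM₀, hq, hc, if_false, zero_add]
      rw [if_neg h1, this, sub_self, norm_zero]
      exact mul_nonneg hu (hB0 p q)
  have hcol : ∀ Q, vecNorm2 (M.col Q) ≤ 6 * m := by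
    intro Q
    obtain ⟨⟨q, b⟩, rfl⟩ := finProdFinEquiv.surjective Q
    refine (vecNorm2_le_sum _).trans ?_
    rw [← finProdFinEquiv.sum_comp, Fintype.sum_prod_type]
    have h1 : ∀ p a, ‖M.col (finProdFinEquiv (q, b)) (finProdFinEquiv (p, a))‖ ≤ (1 + u) * B p q :=
      fun p a => by
        have := norm_le_norm_add_norm_sub' (M' p a q b) (M₀ p a q b)
        have h2 := hMB p a q b
        have h3 := hM₀B p a q b
        rw [Matrix.col_apply]
        change ‖M' p a q b‖ ≤ _
        linarith
    refine (Finset.sum_le_sum fun p _ => Finset.sum_le_sum fun a _ => h1 p a).trans ?_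
    simp only [Finset.sum_const, Finset.card_univ, Fintype.card_fin]
    rw [← Finset.smul_sum, ← Finset.mul_sum]
    have h2 : ∑ p, B p q = 2 * m := by
      simp only [hB]
      rw [Finset.sum_add_distrib, sum_cyc (fun p => if q = p then m else 0)]
      simp
      ring
    rw [h2, nsmul_eq_mul]
    push_cast
    nlinarith
  set Y : Fin (ℓ * 2) → ℝ := fun P => realStack y (finProdFinEquiv.symm P) with hY
  set z := flR.cyclicSolve 2 M Y with hz
  have hxz : ∀ q b, z (finProdFinEquiv (q, b)) = reIm (x q) b := by
    intro q b
    fin_cases b <;> rfl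
  have hpat : ∀ i j : Fin (ℓ * 2), i.val + 2 < ℓ * 2 → j.val / 2 < i.val / 2 → M i j = 0 := by
    intro i j hi hji
    obtain ⟨⟨p, a⟩, rfl⟩ := finProdFinEquiv.surjective i
    obtain ⟨⟨q, b⟩, rfl⟩ := finProdFinEquiv.surjective j
    have ha := a.2
    have hb := b.2
    simp only [finProdFinEquiv_apply_val] at hi hji
    change M' p a q b = 0
    have h1 : ℓ ≠ 1 := by omega
    have h2 : q ≠ p := by
      rintro rfl
      omega
    have h3 : q.val ≠ (p.val + 1) % ℓ := by
      rw [Nat.mod_eq_of_lt (by omega)]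
      omega
    rw [hMval, if_neg h1, if_neg h2, if_neg h3]
  have hres := cyclicSolve_residual flR hu two_pos
    (by push_cast; linarith) hpat hd Y
  have hx0 : ∀ q, ‖x q‖ ≤ ∑ q, ‖x q‖ := fun q =>
    Finset.single_le_sum (f := fun q => ‖x q‖) (fun _ _ => norm_nonneg _) (Finset.mem_univ q)
  set s := ∑ q, ‖x q‖ with hsd
  have hs : 0 ≤ s := Finset.sum_nonneg fun _ _ => norm_nonneg _
  have hV : ∑ j, ‖z j‖ * vecNorm2 (M.col j) ≤ 12 * m * s := by
    rw [← finProdFinEquiv.sum_comp, Fintype.sum_prod_type, hsd, Finset.mul_sum]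
    refine Finset.sum_le_sum fun q _ => ?_
    rw [Fin.sum_univ_two, hxz, hxz]
    have h1 : ∀ b, ‖reIm (x q) b‖ * vecNorm2 (M.col (finProdFinEquiv (q, b))) ≤
        ‖x q‖ * (6 * m) := fun b =>
      mul_le_mul (abs_reIm_le _ _) (hcol _) (vecNorm2_nonneg _) (norm_nonneg _)
    linarith [h1 0, h1 1]
  have hMz : ∀ a, M.mulVec z (finProdFinEquiv (p, a)) = ∑ q, ∑ b, M' p a q b * reIm (x q) b := by
    intro a
    rw [Matrix.mulVec, dotProduct, ← finProdFinEquiv.sum_comp, Fintype.sum_prod_type]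
    simp only [hxz, hM']
  set w := α p * x p + β p * (if r ∣ p.val + 1 then star (x (cyc p)) else x (cyc p)) with hw
  have hM₀x : ∀ a, ∑ q, ∑ b, M₀ p a q b * reIm (x q) b = reIm w a := by
    intro a
    have e : ∀ q, ∑ b, M₀ p a q b * reIm (x q) b = (if q = p then reIm (α p * x p) a else 0) +
        (if q = cyc p then
          reIm (β p * (if r ∣ p.val + 1 then star (x (cyc p)) else x (cyc p))) a else 0) := by
      intro q
      simp only [hM₀, add_mul, Finset.sum_add_distrib]
      congr 1
      · split_ifs with h
        · rw [h, ← sum_mulForm]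
        · simp
      · split_ifs with h h'
        · rw [h, ← sum_conjForm]
          simp only [hOpos p h']
        · rw [h, ← sum_mulForm]
          simp only [hOneg p h']
        · simp
    simp only [e, Finset.sum_add_distrib, Finset.sum_ite_eq', Finset.mem_univ, if_true]
    rw [hw]
    unfold reIm
    split_ifs <;> simp
  have hdiff : ∀ a, |M.mulVec z (finProdFinEquiv (p, a)) - reIm w a| ≤ 4 * u * m * s := by
    intro a
    rw [hMz, ← hM₀x, ← Finset.sum_sub_distrib]
    simp only [← Finset.sum_sub_distrib, ← sub_mul]
    have h1 : ∀ q b, |(M' p a q b - M₀ p a q b) * reIm (x q) b| ≤ u * (B p q * ‖x q‖) := by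
      intro q b
      rw [abs_mul, ← mul_assoc]
      exact mul_le_mul (hMB p a q b) (abs_reIm_le _ _) (abs_nonneg _) (mul_nonneg hu (hB0 p q))
    refine (Finset.abs_sum_le_sum_abs _ _).trans ((Finset.sum_le_sum fun q _ =>
      (Finset.abs_sum_le_sum_abs _ _).trans (Finset.sum_le_sum fun b _ => h1 q b)).trans ?_)
    simp only [Finset.sum_const, Finset.card_univ, Fintype.card_fin]
    rw [← Finset.smul_sum, ← Finset.mul_sum]
    have h2 : ∑ q, B p q * ‖x q‖ = m * ‖x p‖ + m * ‖x (cyc p)‖ := by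
      simp [hB, add_mul, Finset.sum_add_distrib]
    rw [h2, nsmul_eq_mul]
    have h3 := mul_le_mul_of_nonneg_left (hx0 p) (mul_nonneg hu hm)
    have h4 := mul_le_mul_of_nonneg_left (hx0 (cyc p)) (mul_nonneg hu hm)
    push_cast
    linarith
  have h3 : u * (m * s) ≤ ℓ * u * (m * s) := mul_le_mul_of_nonneg_right huℓ (mul_nonneg hm hs)
  have h2 : 1000 * (((2 : ℕ) : ℝ) * (ℓ * 2 : ℕ) * u) * ∑ j, ‖z j‖ * vecNorm2 (M.col j) ≤
      1000 * (4 * (ℓ * u)) * (12 * m * s) := by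
    have : ((2 : ℕ) : ℝ) * (ℓ * 2 : ℕ) * u = 4 * (ℓ * u) := by push_cast; ring
    rw [this]
    gcongr
  have hcomp : ∀ a, |reIm (y p - w) a| ≤ 50000 * (ℓ * u) * m * s := by
    intro a
    have h1 := (norm_le_vecNorm2 _ (finProdFinEquiv (p, a))).trans (hres.trans h2)
    have e1 : Y (finProdFinEquiv (p, a)) = reIm (y p) a := by
      simp only [hY, Equiv.symm_apply_apply]
      rfl
    rw [Pi.sub_apply, e1] at h1
    have e2 : reIm (y p - w) a = reIm (y p) a - reIm w a := by
      unfold reIm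
      split_ifs <;> simp
    rw [e2]
    have h4 := abs_sub_le (reIm (y p) a) (M.mulVec z (finProdFinEquiv (p, a))) (reIm w a)
    have h5 := hdiff a
    rw [Real.norm_eq_abs, ← hz] at h1
    have h6 : 0 ≤ u * (m * s) := mul_nonneg hu (mul_nonneg hm hs)
    linarith
  have h6 := hcomp 0
  have h7 := hcomp 1
  have h8 := norm_re_add_im_le (y p - w)
  simp only [reIm, if_true, one_ne_zero, if_false] at h6 h7
  linarith

theorem smallSolve_residual (hu : 0 ≤ u) (st : StarKind) {ℓ : ℕ} (hℓ : 8000 * (ℓ * u) ≤ 1) (r : ℕ)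
    {α β : Fin ℓ → ℂ} {m : ℝ} (hm : 0 ≤ m) (hα : ∀ p, ‖α p‖ ≤ m) (hβ : ∀ p, ‖β p‖ ≤ m)
    (hd : SmallPivots flR flC st r α β) (y : Fin ℓ → ℂ) (p : Fin ℓ) :
    let x := smallSolve flR flC st r α β y
    ‖y p - (α p * x p +
      β p * (if r ∣ p.val + 1 then st.entry (x (cyc p)) else x (cyc p)))‖ ≤
      100000 * (ℓ * u) * m * ∑ q, ‖x q‖ := by
  cases st
  · intro x
    have hℓu : 0 ≤ (ℓ : ℝ) * u := by positivity
    have h := smallT_residual flC hu (by linarith) hm hα hβ hd y p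
    simp only [StarKind.entry, ite_self]
    refine h.trans (mul_le_mul_of_nonneg_right (mul_le_mul_of_nonneg_right (by linarith) hm)
      (Finset.sum_nonneg fun _ _ => norm_nonneg _))
  · exact smallH_residual flR flC hu hℓ r hm hα hβ hd y p

end SmallSystems

/-! ## The order of the block back substitution -/

section Order

variable {n : ℕ}

/-- The pair `(i, j)`, `j ≤ i`, whose small system determines the entry `(a, b)`. -/
def blockOf (a b : Fin n) : Fin n × Fin n := if b ≤ a then (a, b) else (b, a)

/-- The lexicographic order of pairs. -/
def LexLt (p q : Fin n × Fin n) : Prop := p.1 < q.1 ∨ p.1 = q.1 ∧ p.2 < q.2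

theorem blockOf_comm (a b : Fin n) : blockOf a b = blockOf b a := by
  unfold blockOf
  split_ifs with h1 h2 h2
  · rw [le_antisymm h1 h2]
  · rfl
  · rfl
  · exact absurd (le_total a b) (by simp [h1, h2])

theorem blockOf_snd_le (a b : Fin n) : (blockOf a b).2 ≤ (blockOf a b).1 := by
  unfold blockOf
  split_ifs with h
  · exact h
  · exact (not_le.1 h).le

theorem blockOf_eq_iff {i j a b : Fin n} (h : j ≤ i) :
    blockOf a b = (i, j) ↔ (a = i ∧ b = j) ∨ (a = j ∧ b = i) := by
  unfold blockOf
  split_ifs with h1 <;> simp only [Prod.mk.injEq, Fin.ext_iff, Fin.le_def] at * <;> omega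

theorem lexLt_irrefl (p : Fin n × Fin n) : ¬ LexLt p p := by simp [LexLt]

theorem lexLt_asymm {p q : Fin n × Fin n} (h : LexLt p q) : ¬ LexLt q p := by
  unfold LexLt at *
  simp only [Fin.lt_def, Fin.ext_iff] at *
  omega

/-- Raising one index raises the decreasingly sorted pair lexicographically, even across the
diagonal. In the reversed order, everything to the right of or below a position is therefore solved
earlier. -/
theorem lexLt_blockOf_right {a b t : Fin n} (h : b < t) : LexLt (blockOf a b) (blockOf a t) := by
  unfold LexLt blockOf
  split_ifs <;> simp only [Fin.lt_def, Fin.ext_iff, Fin.le_def, true_and] at * <;> omega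

theorem lexLt_blockOf_left {a b t : Fin n} (h : a < t) : LexLt (blockOf a b) (blockOf t b) := by
  rw [blockOf_comm a, blockOf_comm t]
  exact lexLt_blockOf_right h

theorem not_lexLt_blockOf {a b t : Fin n} (h : b ≤ t) : ¬ LexLt (blockOf a t) (blockOf a b) := by
  rcases h.lt_or_eq with h | rfl
  · exact lexLt_asymm (lexLt_blockOf_right h)
  · exact lexLt_irrefl _

theorem mem_blockList {p : Fin n × Fin n} : p ∈ blockList n ↔ p.2 ≤ p.1 := by
  obtain ⟨i, j⟩ := p
  simp [blockList]

theorem pairwise_blockList : (blockList n).Pairwise LexLt := by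
  unfold blockList
  rw [List.pairwise_flatMap]
  constructor
  · intro i _
    rw [List.pairwise_map]
    exact ((List.pairwise_lt_finRange n).filter _).imp fun h => Or.inr ⟨rfl, h⟩
  · refine (List.pairwise_lt_finRange n).imp fun h x hx y hy => ?_
    obtain ⟨_, _, rfl⟩ := List.mem_map.1 hx
    obtain ⟨_, _, rfl⟩ := List.mem_map.1 hy
    exact Or.inl h

end Order

/-! ### Stages of the block back substitution -/

section Outer

theorem nextX_apply {r n : ℕ} (st : StarKind) (X : Fin r → Matrix (Fin n) (Fin n) ℂ) (k : Fin r)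
    (a b : Fin n) : nextX st X k a b =
      if k.val + 1 < r then X (cyc k) a b else st.entry (X (cyc k) b a) := by
  unfold nextX
  split_ifs with h
  · rw [cyc_of_lt h]
  · have hk := k.2
    rw [cyc_of_eq (by omega)]
    cases st <;> rfl

theorem nextX_congr {r n : ℕ} (st : StarKind) {X Y : Fin r → Matrix (Fin n) (Fin n) ℂ}
    {a b : Fin n} (h : ∀ k, X k a b = Y k a b) (h' : ∀ k, X k b a = Y k b a) (k : Fin r) :
    nextX st X k a b = nextX st Y k a b := by
  rw [nextX_apply, nextX_apply, h, h']

theorem nextX_eq_zero {r n : ℕ} (st : StarKind) {X : Fin r → Matrix (Fin n) (Fin n) ℂ}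
    {a b : Fin n} (h : ∀ k, X k a b = 0) (h' : ∀ k, X k b a = 0) (k : Fin r) :
    nextX st X k a b = 0 := by
  rw [nextX_apply, h, h']
  cases st <;> simp [StarKind.entry]

variable {u : ℝ} (flR : FloatArith ℝ u) (flC : FloatArith ℂ u) {r n : ℕ} (st : StarKind)
  (S : PeriodicSystem r n)

/-- Agreement of two states in the entries `(a, b)`. -/
def State.AgreeAt (s s' : State r n) (a b : Fin n) : Prop :=
  ∀ k, s.X k a b = s'.X k a b ∧ s.XB k a b = s'.XB k a b ∧ s.XD k a b = s'.XD k a b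

theorem step_agreeAt {ij : Fin n × Fin n} (hij : ij.2 ≤ ij.1) (s : State r n) {a b : Fin n}
    (h : blockOf a b ≠ ij) : (step flR flC st S s ij).AgreeAt s a b := by
  rw [Ne, ← Prod.mk.eta (p := ij), blockOf_eq_iff hij] at h
  have h1 : ¬ (a = ij.1 ∧ b = ij.2) := fun hc => h (Or.inl hc)
  have h2 : ¬ (a = ij.2 ∧ b = ij.1) := fun hc => h (Or.inr hc)
  intro k
  refine ⟨?_, ?_, ?_⟩
  · change (if _ then _ else if _ then _ else _) = _
    rw [if_neg h1, if_neg h2]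
  · exact if_neg h
  · exact if_neg h

theorem foldl_step_agreeAt (l : List (Fin n × Fin n)) (hl : ∀ ij ∈ l, ij.2 ≤ ij.1) (s : State r n)
    {a b : Fin n} (h : blockOf a b ∉ l) : (l.foldl (step flR flC st S) s).AgreeAt s a b := by
  induction l generalizing s with
  | nil => exact fun _ => ⟨rfl, rfl, rfl⟩
  | cons c l ih =>
    rw [List.mem_cons, not_or] at h
    intro k
    obtain ⟨h1, h2, h3⟩ := ih (fun ij hij => hl ij (List.mem_cons_of_mem _ hij))
      (step flR flC st S s c) h.2 k
    obtain ⟨g1, g2, g3⟩ := step_agreeAt flR flC st S (hl c (by simp)) s h.1 k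
    exact ⟨h1.trans g1, h2.trans g2, h3.trans g3⟩

/-- The initial state. -/
def zeroState (r n : ℕ) : State r n := { X := fun _ => 0, XB := fun _ => 0, XD := fun _ => 0 }

/-- The final state. -/
noncomputable def finalState : State r n :=
  (blockList n).reverse.foldl (step flR flC st S) (zeroState r n)

/-- `s` is the state before the step of the pair `ij`. -/
structure IsStage (ij : Fin n × Fin n) (s : State r n) : Prop where
  done : ∀ a b, LexLt ij (blockOf a b) → s.AgreeAt (finalState flR flC st S) a b
  todo : ∀ a b, ¬ LexLt ij (blockOf a b) → s.AgreeAt (zeroState r n) a b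
  step_done : ∀ a b, ¬ LexLt (blockOf a b) ij →
    (finalState flR flC st S).AgreeAt (step flR flC st S s ij) a b

/-- The reversed list is cut at `ij`: the steps in front treat only larger pairs, those behind only
smaller ones, and a step changes no entry outside its own block. -/
theorem exists_isStage {ij : Fin n × Fin n} (h : ij.2 ≤ ij.1) :
    ∃ s, IsStage flR flC st S ij s := by
  obtain ⟨L₁, L₂, hL⟩ := List.append_of_mem (List.mem_reverse.2 (mem_blockList.2 h))
  have hp : (L₁ ++ ij :: L₂).Pairwise (fun a b => LexLt b a) := by
    rw [← hL, List.pairwise_reverse]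
    exact pairwise_blockList
  have hm : ∀ p ∈ L₁ ++ ij :: L₂, p.2 ≤ p.1 := fun p hp => by
    rw [← hL, List.mem_reverse, mem_blockList] at hp
    exact hp
  rw [List.pairwise_append, List.pairwise_cons] at hp
  obtain ⟨-, ⟨hp2, -⟩, hp1⟩ := hp
  have hF : finalState flR flC st S = L₂.foldl (step flR flC st S)
      (step flR flC st S (L₁.foldl (step flR flC st S) (zeroState r n)) ij) := by
    rw [finalState, hL, List.foldl_append, List.foldl_cons]
  have hF' : finalState flR flC st S = (ij :: L₂).foldl (step flR flC st S)
      (L₁.foldl (step flR flC st S) (zeroState r n)) := by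
    rw [finalState, hL, List.foldl_append]
  refine ⟨L₁.foldl (step flR flC st S) (zeroState r n), ⟨fun a b hab k => ?_, fun a b hab => ?_,
    fun a b hab => ?_⟩⟩
  · rw [hF']
    obtain ⟨h1, h2, h3⟩ := foldl_step_agreeAt flR flC st S (ij :: L₂)
      (fun p hp => hm p (List.mem_append_right _ hp))
      (L₁.foldl (step flR flC st S) (zeroState r n)) (a := a) (b := b) (fun hc => by
        rcases List.mem_cons.1 hc with hc | hc
        · exact lexLt_irrefl _ (hc ▸ hab)
        · exact lexLt_asymm hab (hp2 _ hc)) k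
    exact ⟨h1.symm, h2.symm, h3.symm⟩
  · exact foldl_step_agreeAt flR flC st S L₁ (fun p hp => hm p (List.mem_append_left _ hp)) _
      fun hc => hab (hp1 _ hc ij (by simp))
  · rw [hF]
    exact foldl_step_agreeAt flR flC st S L₂
      (fun p hp => hm p (List.mem_append_right _ (List.mem_cons_of_mem _ hp))) _
      fun hc => hab (hp2 _ hc)

/-- The vector `v` is row `a` of `X_k` at the moment of storage. Its entries before `b` may change
later, but they will be multiplied by zeros of the column `b` of `B_k`. -/
theorem finalState_XB (k : Fin r) (a b : Fin n) : ∃ v : Fin n → ℂ,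
    (∀ t, b ≤ t → v t = (finalState flR flC st S).X k a t) ∧
    (finalState flR flC st S).XB k a b = flC.dot v (fun t => S.B k t b) := by
  obtain ⟨s, hs⟩ := exists_isStage flR flC st S (blockOf_snd_le a b)
  refine ⟨fun t => (step flR flC st S s (blockOf a b)).X k a t,
    fun t ht => ((hs.step_done a t (not_lexLt_blockOf ht)) k).1.symm,
    (((hs.step_done a b (lexLt_irrefl _)) k).2.1).trans ?_⟩
  exact if_pos ((blockOf_eq_iff (blockOf_snd_le a b)).1 rfl)

/-- The wrapped unknown `X_1^⋆` reads `(t, a)` instead of `(a, t)`; both entries belong to the same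
block, so they become final together. -/
theorem finalState_XD (k : Fin r) (a b : Fin n) : ∃ v : Fin n → ℂ,
    (∀ t, b ≤ t → v t = nextX st (finalState flR flC st S).X k a t) ∧
    (finalState flR flC st S).XD k a b = flC.dot v (fun t => S.D k t b) := by
  obtain ⟨s, hs⟩ := exists_isStage flR flC st S (blockOf_snd_le a b)
  refine ⟨fun t => nextX st (step flR flC st S s (blockOf a b)).X k a t, fun t ht => ?_,
    (((hs.step_done a b (lexLt_irrefl _)) k).2.2).trans ?_⟩
  · exact nextX_congr st (fun k => ((hs.step_done a t (not_lexLt_blockOf ht)) k).1.symm)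
      (fun k => ((hs.step_done t a (by rw [blockOf_comm t]; exact not_lexLt_blockOf ht)) k).1.symm) k
  · exact if_pos ((blockOf_eq_iff (blockOf_snd_le a b)).1 rfl)

theorem finalState_X {i j : Fin n} (hij : j ≤ i) {s : State r n}
    (hs : IsStage flR flC st S (i, j) s) (k : Fin r) :
    (finalState flR flC st S).X k i j = (solveBlock flR flC st S s i j).1 k ∧
    (finalState flR flC st S).X k j i = (solveBlock flR flC st S s i j).2 k := by
  have e1 : blockOf i j = (i, j) := (blockOf_eq_iff hij).2 (Or.inl ⟨rfl, rfl⟩)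
  have h1 := (hs.step_done i j (e1 ▸ lexLt_irrefl _) k).1
  have h2 := (hs.step_done j i (by rw [blockOf_comm, e1]; exact lexLt_irrefl _) k).1
  refine ⟨h1.trans (if_pos ⟨rfl, rfl⟩), h2.trans ?_⟩
  by_cases h : i = j
  · subst h
    refine (if_pos ⟨rfl, rfl⟩).trans ?_
    simp [solveBlock]
  · exact (if_neg (fun hc => h hc.2)).trans (if_pos ⟨rfl, rfl⟩)

/-! ## The error of the right-hand sides -/

/-- The entry `(i, j)` of `|A| |X| |B|`. -/
noncomputable def absProd (A X B : Matrix (Fin n) (Fin n) ℂ) (i j : Fin n) : ℝ :=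
  ∑ t, ‖A i t‖ * ∑ b, ‖X t b‖ * ‖B b j‖

theorem absProd_nonneg (A X B : Matrix (Fin n) (Fin n) ℂ) (i j : Fin n) : 0 ≤ absProd A X B i j :=
  Finset.sum_nonneg fun _ _ => mul_nonneg (norm_nonneg _)
    (Finset.sum_nonneg fun _ _ => mul_nonneg (norm_nonneg _) (norm_nonneg _))

theorem norm_mul_le_absProd (A X B : Matrix (Fin n) (Fin n) ℂ) (i j : Fin n) :
    ‖A i i * B j j‖ * ‖X i j‖ ≤ absProd A X B i j := by
  have h1 : ‖X i j‖ * ‖B j j‖ ≤ ∑ b, ‖X i b‖ * ‖B b j‖ :=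
    Finset.single_le_sum (f := fun b => ‖X i b‖ * ‖B b j‖)
      (fun _ _ => mul_nonneg (norm_nonneg _) (norm_nonneg _)) (Finset.mem_univ j)
  have h2 : ‖A i i‖ * ∑ b, ‖X i b‖ * ‖B b j‖ ≤ absProd A X B i j :=
    Finset.single_le_sum (f := fun t => ‖A i t‖ * ∑ b, ‖X t b‖ * ‖B b j‖)
      (fun _ _ => mul_nonneg (norm_nonneg _)
        (Finset.sum_nonneg fun _ _ => mul_nonneg (norm_nonneg _) (norm_nonneg _)))
      (Finset.mem_univ i)
  refine le_trans ?_ h2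
  rw [norm_mul, mul_assoc, mul_comm ‖B j j‖]
  exact mul_le_mul_of_nonneg_left h1 (norm_nonneg _)

/-- The error of the computed known part of `(A X B)_{ij}`, where `xs` holds the known entries of
the row `i` of `X` and `ys` the known entries of the column `j` of the stored product `X B`. -/
theorem approx_side (hu : 0 ≤ u) {A B X : Matrix (Fin n) (Fin n) ℂ} {i j : Fin n}
    (hA : ∀ t, t < i → A i t = 0) (hB : ∀ t, t < j → B t j = 0) {xs ys : Fin n → ℂ}
    (hxs : ∀ t, j < t → xs t = X i t) (hxj : xs j = 0) (hyi : ys i = 0)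
    (hys : ∀ t, i < t → ∃ v : Fin n → ℂ, (∀ b, j ≤ b → v b = X t b) ∧
      ys t = flC.dot v (fun b => B b j)) :
    Approx u (2 * n + 3) ((A * X * B) i j - A i i * B j j * X i j) (absProd A X B i j)
      (flC.add (flC.mul (A i i) (flC.dot xs (fun t => B t j))) (flC.dot (fun t => A i t) ys)) := by
  set z : Fin n → ℂ := fun t => ∑ b, X t b * B b j with hz
  set Z : Fin n → ℝ := fun t => ∑ b, ‖X t b‖ * ‖B b j‖ with hZ
  have h1 := (approx_dot flC hu (fun t => Approx.refl (xs t)) (fun t => Approx.refl (B t j)))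
  have h2 := (Approx.refl (u := u) (A i i)).mul flC hu h1
  -- Only rows `t > i` hold usable products. For `t < i` the content of `ys` is irrelevant, since `A
  -- i t = 0`, and `ys i = 0`.
  have hy : ∀ t, Approx u (n + 1) (if i < t then z t else ys t) (if i < t then Z t else ‖ys t‖)
      (ys t) := by
    intro t
    by_cases h : i < t
    · simp only [h, if_true]
      obtain ⟨v, hv, e⟩ := hys t h
      have h3 := approx_dot flC hu (fun b => Approx.refl (v b)) (fun b => Approx.refl (B b j))
      rw [← e] at h3
      have e1 : ∑ b, v b * B b j = z t := Finset.sum_congr rfl fun b _ => by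
        by_cases hb : b < j
        · rw [hB b hb, mul_zero, mul_zero]
        · rw [hv b (not_lt.1 hb)]
      have e2 : ∑ b, ‖v b‖ * ‖B b j‖ = Z t := Finset.sum_congr rfl fun b _ => by
        by_cases hb : b < j
        · rw [hB b hb, norm_zero, mul_zero, mul_zero]
        · rw [hv b (not_lt.1 hb)]
      rw [e1, e2] at h3
      exact h3.mono hu (by omega) le_rfl
    · simp only [h, if_false]
      exact (Approx.refl _).mono hu (by omega) le_rfl
  have h3 := approx_dot flC hu (fun t => Approx.refl (A i t)) hy
  have h4 := (h2.mono hu (show _ ≤ 2 * n + 2 by omega) le_rfl).add flC hu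
    (h3.mono hu (show _ ≤ 2 * n + 2 by omega) le_rfl)
  have e1 : ∑ t, xs t * B t j = z i - X i j * B j j := by
    have : X i j * B j j = ∑ t, if t = j then X i t * B t j else 0 := by simp
    rw [this, hz, ← Finset.sum_sub_distrib]
    refine Finset.sum_congr rfl fun t _ => ?_
    rcases lt_trichotomy t j with h | h | h
    · simp [hB t h]
    · simp [h, hxj]
    · simp [hxs t h, h.ne']
  have e2 : ∑ t, A i t * (if i < t then z t else ys t) = (∑ t, A i t * z t) - A i i * z i := by
    have : A i i * z i = ∑ t, if t = i then A i t * z t else 0 := by simp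
    rw [this, ← Finset.sum_sub_distrib]
    refine Finset.sum_congr rfl fun t _ => ?_
    rcases lt_trichotomy t i with h | h | h
    · simp [hA t h]
    · simp [h, hyi]
    · simp [h, h.ne']
  have e3 : (A * X * B) i j = ∑ t, A i t * z t := by
    rw [Matrix.mul_assoc, Matrix.mul_apply]
    rfl
  -- The row `i` of `X B` is absent from the stored products and is supplied, without the unknown `X
  -- i j`, by the separate scalar product; together only the diagonal term is missing.
  have e4 : A i i * (z i - X i j * B j j) + ((∑ t, A i t * z t) - A i i * z i) =
      (A * X * B) i j - A i i * B j j * X i j := by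
    rw [e3]
    ring
  rw [e1, e2, e4] at h4
  refine h4.mono hu le_rfl ?_
  have i1 : ∑ t, ‖xs t‖ * ‖B t j‖ ≤ Z i := by
    refine Finset.sum_le_sum fun t _ => ?_
    rcases lt_trichotomy t j with h | h | h
    · simp [hB t h]
    · simp only [h, hxj, norm_zero, zero_mul]
      positivity
    · rw [hxs t h]
  have i2 : ∑ t, ‖A i t‖ * (if i < t then Z t else ‖ys t‖) =
      (∑ t, ‖A i t‖ * Z t) - ‖A i i‖ * Z i := by
    have : ‖A i i‖ * Z i = ∑ t, if t = i then ‖A i t‖ * Z t else 0 := by simp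
    rw [this, ← Finset.sum_sub_distrib]
    refine Finset.sum_congr rfl fun t _ => ?_
    rcases lt_trichotomy t i with h | h | h
    · simp [hA t h]
    · simp [h, hyi]
    · simp [h, h.ne']
  rw [i2]
  have i3 := mul_le_mul_of_nonneg_left i1 (norm_nonneg (A i i))
  have i4 : absProd A X B i j = ∑ t, ‖A i t‖ * Z t := rfl
  linarith

/-- The coefficient matrices have the triangular structure of the theorem. -/
structure PeriodicSystem.IsTriangular (S : PeriodicSystem r n) : Prop where
  A : ∀ k, (S.A k).BlockTriangular id
  C : ∀ k, (S.C k).BlockTriangular id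
  B : ∀ k, (S.B k).transpose.BlockTriangular id
  D : ∀ k, (S.D k).transpose.BlockTriangular id

/-- `|A_k| |X_k| |B_k| + |C_k| |X_{k+1}| |D_k|`. -/
noncomputable def termSize (X : Fin r → Matrix (Fin n) (Fin n) ℂ) (k : Fin r) (i j : Fin n) : ℝ :=
  absProd (S.A k) (X k) (S.B k) i j + absProd (S.C k) (nextX st X k) (S.D k) i j

/-- Before the stage of `(i, j)` every entry needed is either final or still zero, so `approx_side`
applies to both products; the two subtractions raise `2n + 3` to `2n + 5`. -/
theorem approx_smallRhs (hu : 0 ≤ u) (hS : S.IsTriangular) (i j : Fin n) {s : State r n}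
    (hs : IsStage flR flC st S (blockOf i j) s) (k : Fin r) :
    let X := (finalState flR flC st S).X
    Approx u (2 * n + 5)
      (S.E k i j - (((S.A k * X k * S.B k) i j - S.A k i i * S.B k j j * X k i j) -
        ((S.C k * nextX st X k * S.D k) i j - S.C k i i * S.D k j j * nextX st X k i j)))
      (‖S.E k i j‖ + termSize st S X k i j) (smallRhs flC st S s i j k) := by
  intro X
  have hij := hs.todo i j (lexLt_irrefl _)
  have hji := hs.todo j i (by rw [blockOf_comm]; exact lexLt_irrefl _)
  have h1 := approx_side flC hu (A := S.A k) (B := S.B k) (X := X k) (i := i) (j := j)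
    (fun t ht => hS.A k ht) (fun t ht => hS.B k ht)
    (xs := fun t => s.X k i t) (ys := fun t => s.XB k t j)
    (fun t ht => (hs.done i t (lexLt_blockOf_right ht) k).1) (hij k).1 (hij k).2.1
    (fun t ht => by
      rw [(hs.done t j (lexLt_blockOf_left ht) k).2.1]
      exact finalState_XB flR flC st S k t j)
  have h2 := approx_side flC hu (A := S.C k) (B := S.D k) (X := nextX st X k) (i := i) (j := j)
    (fun t ht => hS.C k ht) (fun t ht => hS.D k ht)
    (xs := fun t => nextX st s.X k i t) (ys := fun t => s.XD k t j)
    (fun t ht => nextX_congr st (fun k => (hs.done i t (lexLt_blockOf_right ht) k).1)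
      (fun k => (hs.done t i (by rw [blockOf_comm t]; exact lexLt_blockOf_right ht) k).1) k)
    (nextX_eq_zero st (fun k => (hij k).1) (fun k => (hji k).1) k) (hij k).2.2
    (fun t ht => by
      rw [(hs.done t j (lexLt_blockOf_left ht) k).2.2]
      exact finalState_XD flR flC st S k t j)
  exact ((Approx.refl (S.E k i j)).mono hu (Nat.zero_le _) le_rfl).sub flC hu (h1.sub flC hu h2)

/-! ## The entrywise residual -/

theorem norm_coefA_le {m : ℝ} {i j : Fin n} {k : Fin r} (hu1 : u ≤ 1)
    (h : ‖S.A k i i * S.B k j j‖ ≤ m) : ‖coefA flC S i j k‖ ≤ 2 * m := by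
  have h1 := (flC.mul_spec (S.A k i i) (S.B k j j)).norm_le
  have h2 : ‖coefA flC S i j k‖ = ‖flC.mul (S.A k i i) (S.B k j j)‖ := rfl
  nlinarith [norm_nonneg (S.A k i i * S.B k j j)]

theorem norm_coefC_le {m : ℝ} {i j : Fin n} {k : Fin r} (hu1 : u ≤ 1)
    (h : ‖S.C k i i * S.D k j j‖ ≤ m) : ‖coefC flC S i j k‖ ≤ 2 * m := by
  have h1 := (flC.mul_spec (S.C k i i) (S.D k j j)).norm_le
  have h2 : ‖coefC flC S i j k‖ = ‖flC.mul (S.C k i i) (S.D k j j)‖ := norm_neg _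
  nlinarith [norm_nonneg (S.C k i i * S.D k j j)]

/-- The size of all entries `(i, j)` and `(j, i)` of the solution. -/
noncomputable def entrySum (X : Fin r → Matrix (Fin n) (Fin n) ℂ) (i j : Fin n) : ℝ :=
  ∑ k, (‖X k i j‖ + ‖X k j i‖)

theorem entrySum_comm (X : Fin r → Matrix (Fin n) (Fin n) ℂ) (i j : Fin n) :
    entrySum X i j = entrySum X j i := by
  simp only [entrySum, add_comm]

/-- Translates the residual of the small solver into the entries of `X_k`. Order `2r` and computed
coefficients of size at most `2m` turn `100000` into `400000`. -/
theorem stage_residual (hu : 0 ≤ u) (hr : 16000 * (r * u) ≤ 1) {m : ℝ} (hm : 0 ≤ m)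
    (hAB : ∀ k i j, ‖S.A k i i * S.B k j j‖ ≤ m) (hCD : ∀ k i j, ‖S.C k i i * S.D k j j‖ ≤ m)
    (hd : NoBreakdown flR flC st S) {i j : Fin n} (hij : j ≤ i) {s : State r n}
    (hs : IsStage flR flC st S (i, j) s) (k : Fin r) :
    let X := (finalState flR flC st S).X
    ‖smallRhs flC st S s i j k -
      (coefA flC S i j k * X k i j + coefC flC S i j k * nextX st X k i j)‖ ≤
        400000 * (r * u) * m * entrySum X i j ∧
    ‖smallRhs flC st S s j i k -
      (coefA flC S j i k * X k j i + coefC flC S j i k * nextX st X k j i)‖ ≤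
        400000 * (r * u) * m * entrySum X i j := by
  intro X
  have hr1 : (1 : ℝ) ≤ r := by exact_mod_cast k.pos
  have hru : u ≤ r * u := le_mul_of_one_le_left hu hr1
  have hru0 : 0 ≤ r * u := by positivity
  have hu1 : u ≤ 1 := by linarith
  have hA : ∀ i j k, ‖coefA flC S i j k‖ ≤ 2 * m := fun i j k =>
    norm_coefA_le flC S hu1 (hAB k i j)
  have hC : ∀ i j k, ‖coefC flC S i j k‖ ≤ 2 * m := fun i j k =>
    norm_coefC_le flC S hu1 (hCD k i j)
  have hX := finalState_X flR flC st S hij hs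
  have hes : 0 ≤ entrySum X i j := Finset.sum_nonneg fun _ _ => by positivity
  have hbig : 0 ≤ (r * u) * m * entrySum X i j := by positivity
  have hkr := k.2
  by_cases h : i = j
  · subst h
    have hx : ∀ k, X k i i = smallSolve flR flC st r (coefA flC S i i) (coefC flC S i i)
        (smallRhs flC st S s i i) k := fun k => (hX k).1.trans (by simp [solveBlock])
    have h1 := smallSolve_residual flR flC hu st (by linarith) r (by positivity : 0 ≤ 2 * m)
      (hA i i) (hC i i) (hd.1 i) (smallRhs flC st S s i i) k
    simp only [← hx] at h1
    have e : (if r ∣ k.val + 1 then st.entry (X (cyc k) i i) else X (cyc k) i i) =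
        nextX st X k i i := by
      rw [nextX_apply]
      by_cases hk : k.val + 1 < r
      · rw [if_pos hk, if_neg (Nat.not_dvd_of_pos_of_lt (Nat.succ_pos _) hk)]
      · rw [if_neg hk, if_pos (by rw [show k.val + 1 = r by omega])]
    rw [e] at h1
    have h2 : ∑ q, ‖X q i i‖ ≤ entrySum X i i :=
      Finset.sum_le_sum fun q _ => by linarith [norm_nonneg (X q i i)]
    have h3 := mul_le_mul_of_nonneg_left h2 (by positivity : 0 ≤ 100000 * (r * u) * (2 * m))
    have h4 := h1.trans h3
    constructor <;> linarith
  · set α := Fin.append (coefA flC S i j) (coefA flC S j i) with hα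
    set β := Fin.append (coefC flC S i j) (coefC flC S j i) with hβ
    set y := Fin.append (smallRhs flC st S s i j) (smallRhs flC st S s j i) with hy
    set x := smallSolve flR flC st r α β y with hx
    have hx1 : ∀ k, x (Fin.castAdd r k) = X k i j := fun k =>
      ((hX k).1.trans (by simp [solveBlock, h, hx, hα, hβ, hy])).symm
    have hx2 : ∀ k, x (Fin.natAdd r k) = X k j i := fun k =>
      ((hX k).2.trans (by simp [solveBlock, h, hx, hα, hβ, hy])).symm
    have hle : ∀ f g : Fin r → ℂ, (∀ k, ‖f k‖ ≤ 2 * m) → (∀ k, ‖g k‖ ≤ 2 * m) →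
        ∀ p, ‖Fin.append f g p‖ ≤ 2 * m := by
      intro f g hf hg p
      refine Fin.addCases (fun q => ?_) (fun q => ?_) p
      · rw [Fin.append_left]
        exact hf q
      · rw [Fin.append_right]
        exact hg q
    have hres := smallSolve_residual flR flC hu st (ℓ := r + r) (by push_cast; linarith) r
      (by positivity : 0 ≤ 2 * m) (hle _ _ (hA i j) (hA j i)) (hle _ _ (hC i j) (hC j i))
      (hd.2 i j (lt_of_le_of_ne hij (Ne.symm h))) y
    have hsum : ∑ q, ‖x q‖ = entrySum X i j := by
      rw [Fin.sum_univ_add, entrySum, Finset.sum_add_distrib]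
      simp only [hx1, hx2]
    have hc : ∀ p, ‖y p - (α p * x p +
        β p * (if r ∣ p.val + 1 then st.entry (x (cyc p)) else x (cyc p)))‖ ≤
        400000 * (r * u) * m * entrySum X i j := by
      intro p
      have := hres p
      simp only [← hα, ← hβ, ← hx, hsum] at this
      refine this.trans (le_of_eq ?_)
      push_cast
      ring
    constructor
    · have h1 := hc (Fin.castAdd r k)
      -- The cycle of length `2r` matches the periodic system: after position `r - 1` it moves from
      -- the entries `(i, j)` to the first entry `(j, i)`, as `X_1^⋆` requires, and after position
      -- `2r - 1` back to the start. These are the positions where `r ∣ p + 1`.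
      have e : (if r ∣ (Fin.castAdd r k).val + 1 then st.entry (x (cyc (Fin.castAdd r k)))
          else x (cyc (Fin.castAdd r k))) = nextX st X k i j := by
        rw [nextX_apply, Fin.val_castAdd]
        by_cases hk : k.val + 1 < r
        · rw [if_pos hk, if_neg (Nat.not_dvd_of_pos_of_lt (Nat.succ_pos _) hk), ← hx1]
          congr 1
          rw [cyc_of_lt hk, cyc_of_lt (show (Fin.castAdd r k).val + 1 < r + r by simp; omega)]
          rfl
        · rw [if_neg hk, if_pos (by rw [show k.val + 1 = r by omega]), ← hx2]
          congr 2
          rw [cyc_of_eq (show k.val + 1 = r by omega),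
            cyc_of_lt (show (Fin.castAdd r k).val + 1 < r + r by simp; omega)]
          ext
          simp
          omega
      rw [e, hx1, hα, hβ, hy, Fin.append_left, Fin.append_left, Fin.append_left] at h1
      exact h1
    · have h1 := hc (Fin.natAdd r k)
      have e : (if r ∣ (Fin.natAdd r k).val + 1 then st.entry (x (cyc (Fin.natAdd r k)))
          else x (cyc (Fin.natAdd r k))) = nextX st X k j i := by
        have hdvd : r ∣ (Fin.natAdd r k).val + 1 ↔ r ∣ k.val + 1 := by
          rw [Fin.val_natAdd, add_assoc, Nat.dvd_add_right (dvd_refl r)]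
        rw [nextX_apply]
        by_cases hk : k.val + 1 < r
        · rw [if_pos hk, if_neg (hdvd.not.2 (Nat.not_dvd_of_pos_of_lt (Nat.succ_pos _) hk)), ← hx2]
          congr 1
          rw [cyc_of_lt hk, cyc_of_lt (show (Fin.natAdd r k).val + 1 < r + r by simp; omega)]
          rfl
        · rw [if_neg hk, if_pos (hdvd.2 (by rw [show k.val + 1 = r by omega])), ← hx1]
          congr 2
          rw [cyc_of_eq (show k.val + 1 = r by omega),
            cyc_of_eq (show (Fin.natAdd r k).val + 1 = r + r by simp; omega)]
          ext
          simp
      rw [e, hx2, hα, hβ, hy, Fin.append_right, Fin.append_right, Fin.append_right] at h1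
      exact h1

/-- The residual of the computed solution in the equation `(i, j, k)`. -/
theorem entry_residual (hu : 0 ≤ u) (hr : 16000 * (r * u) ≤ 1) (hn : 100 * (n * u) ≤ 1)
    (hS : S.IsTriangular) {m : ℝ} (hm : 0 ≤ m)
    (hAB : ∀ k i j, ‖S.A k i i * S.B k j j‖ ≤ m) (hCD : ∀ k i j, ‖S.C k i i * S.D k j j‖ ≤ m)
    (hd : NoBreakdown flR flC st S) (k : Fin r) (i j : Fin n) :
    let X := (finalState flR flC st S).X
    ‖S.E k i j - ((S.A k * X k * S.B k) i j - (S.C k * nextX st X k * S.D k) i j)‖ ≤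
      20 * (n * u) * (‖S.E k i j‖ + termSize st S X k i j) +
        400000 * (r * u) * m * entrySum X i j := by
  intro X
  have hn1 : (1 : ℝ) ≤ n := by exact_mod_cast i.pos
  have hnu : u ≤ n * u := le_mul_of_one_le_left hu hn1
  obtain ⟨s, hs⟩ := exists_isStage flR flC st S (blockOf_snd_le i j)
  have h1 := approx_smallRhs flR flC st S hu hS i j hs k
  have h2 : ‖smallRhs flC st S s i j k -
      (coefA flC S i j k * X k i j + coefC flC S i j k * nextX st X k i j)‖ ≤
        400000 * (r * u) * m * entrySum X i j := by
    by_cases hij : j ≤ i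
    · rw [blockOf, if_pos hij] at hs
      exact (stage_residual flR flC st S hu hr hm hAB hCD hd hij hs k).1
    · rw [blockOf, if_neg hij] at hs
      rw [entrySum_comm]
      exact (stage_residual flR flC st S hu hr hm hAB hCD hd (not_le.1 hij).le hs k).2
  have h3 := h1.norm_sub_le hu (by push_cast; linarith)
  have h4 : ‖coefA flC S i j k - S.A k i i * S.B k j j‖ ≤ u * ‖S.A k i i * S.B k j j‖ :=
    (flC.mul_spec (S.A k i i) (S.B k j j)).norm_sub_le
  have h5 : ‖coefC flC S i j k + S.C k i i * S.D k j j‖ ≤ u * ‖S.C k i i * S.D k j j‖ := by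
    have := (flC.mul_spec (S.C k i i) (S.D k j j)).norm_sub_le
    rwa [norm_sub_rev, sub_eq_neg_add] at this
  have h6 := norm_mul_le_absProd (S.A k) (X k) (S.B k) i j
  have h7 := norm_mul_le_absProd (S.C k) (nextX st X k) (S.D k) i j
  set α := coefA flC S i j k
  set β := coefC flC S i j k
  set y := smallRhs flC st S s i j k
  set W := S.E k i j - (((S.A k * X k * S.B k) i j - S.A k i i * S.B k j j * X k i j) -
        ((S.C k * nextX st X k * S.D k) i j - S.C k i i * S.D k j j * nextX st X k i j)) with hW
  -- Three contributions: the residual of the small solver, the error of its right-hand side, and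
  -- the rounding of its coefficients.
  have e : S.E k i j - ((S.A k * X k * S.B k) i j - (S.C k * nextX st X k * S.D k) i j) =
      (y - (α * X k i j + β * nextX st X k i j)) - (y - W) +
      ((α - S.A k i i * S.B k j j) * X k i j + (β + S.C k i i * S.D k j j) * nextX st X k i j) := by
    rw [hW]
    ring
  rw [e]
  refine (norm_add_le _ _).trans ?_
  have g1 := norm_sub_le (y - (α * X k i j + β * nextX st X k i j)) (y - W)
  have g2 : ‖(α - S.A k i i * S.B k j j) * X k i j +
      (β + S.C k i i * S.D k j j) * nextX st X k i j‖ ≤ u * termSize st S X k i j := by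
    refine (norm_add_le _ _).trans ?_
    rw [norm_mul, norm_mul, termSize, mul_add]
    refine add_le_add ?_ ?_
    · refine (mul_le_mul_of_nonneg_right h4 (norm_nonneg _)).trans ?_
      rw [mul_assoc]
      exact mul_le_mul_of_nonneg_left h6 hu
    · refine (mul_le_mul_of_nonneg_right h5 (norm_nonneg _)).trans ?_
      rw [mul_assoc]
      exact mul_le_mul_of_nonneg_left h7 hu
  have hT : 0 ≤ termSize st S X k i j := add_nonneg (absProd_nonneg _ _ _ _ _) (absProd_nonneg _ _ _ _ _)
  have hET : 0 ≤ ‖S.E k i j‖ + termSize st S X k i j := by positivity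
  have h8 : u * termSize st S X k i j ≤ n * u * (‖S.E k i j‖ + termSize st S X k i j) :=
    mul_le_mul hnu (by linarith [norm_nonneg (S.E k i j)]) hT (by positivity)
  have h9 : 2 * ((2 * n + 5 : ℕ) : ℝ) * u * (‖S.E k i j‖ + termSize st S X k i j) ≤
      14 * (n * u) * (‖S.E k i j‖ + termSize st S X k i j) := by
    refine mul_le_mul_of_nonneg_right ?_ hET
    push_cast
    linarith
  have h10 : 0 ≤ n * u * (‖S.E k i j‖ + termSize st S X k i j) := by positivity
  linarith

end Outer

/-! ## Residuals and backward errors -/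

section BackwardError

variable {𝕜 ι : Type} [RCLike 𝕜] [Fintype ι]

theorem norm_star_dotProduct_le (x v : ι → 𝕜) : ‖star x ⬝ᵥ v‖ ≤ vecNorm2 x * vecNorm2 v := by
  have h := norm_inner_le_norm (𝕜 := 𝕜) (WithLp.toLp 2 x) (WithLp.toLp 2 v)
  rwa [EuclideanSpace.inner_eq_star_dotProduct, dotProduct_comm] at h

theorem star_dotProduct_self (x : ι → 𝕜) : star x ⬝ᵥ x = ((vecNorm2 x ^ 2 : ℝ) : 𝕜) := by
  rw [vecNorm2_sq, dotProduct]
  push_cast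
  exact Finset.sum_congr rfl fun i _ => RCLike.conj_mul _

variable [DecidableEq ι]

theorem vecNorm2_mulVec_le (M : Matrix ι ι 𝕜) (x : ι → 𝕜) :
    vecNorm2 (M.mulVec x) ≤ norm2 M * vecNorm2 x := by
  let : NormedAddCommGroup (Matrix ι ι 𝕜) := Matrix.instL2OpNormedAddCommGroup
  exact Matrix.l2_opNorm_mulVec M (WithLp.toLp 2 x)

theorem norm2_le {M : Matrix ι ι 𝕜} {C : ℝ} (hC : 0 ≤ C)
    (h : ∀ x, vecNorm2 (M.mulVec x) ≤ C * vecNorm2 x) : norm2 M ≤ C := by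
  rw [norm2, Matrix.l2_opNorm_def]
  exact ContinuousLinearMap.opNorm_le_bound _ hC fun x => h (WithLp.ofLp x)

theorem norm2_nonneg (M : Matrix ι ι 𝕜) : 0 ≤ norm2 M := by
  let : NormedAddCommGroup (Matrix ι ι 𝕜) := Matrix.instL2OpNormedAddCommGroup
  exact norm_nonneg M

theorem sum_col_sq_le (M : Matrix ι ι 𝕜) (b : ι) : ∑ a, ‖M a b‖ ^ 2 ≤ norm2 M ^ 2 := by
  have h := vecNorm2_mulVec_le M (Pi.single b 1)
  have h1 : vecNorm2 (Pi.single b (1 : 𝕜)) = 1 := by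
    simp [vecNorm2]
  rw [h1, mul_one, Matrix.mulVec_single_one] at h
  have h2 := pow_le_pow_left₀ (vecNorm2_nonneg _) h 2
  rwa [vecNorm2_sq] at h2

/-- A small residual is a small backward error. -/
theorem hasBackwardError_of_residual {M : Matrix ι ι 𝕜} {e x : ι → 𝕜} {μ ε η : ℝ}
    (hε : 0 ≤ ε * μ) (hη : 0 ≤ η)
    (h : vecNorm2 (e - M.mulVec x) ≤ ε * μ * vecNorm2 x + η * vecNorm2 e) :
    HasBackwardError M e x μ ε η := by
  set ρ := e - M.mulVec x with hρ
  set s := ε * μ * vecNorm2 x with hs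
  set t := η * vecNorm2 e with ht
  have hs0 : 0 ≤ s := mul_nonneg hε (vecNorm2_nonneg _)
  have ht0 : 0 ≤ t := mul_nonneg hη (vecNorm2_nonneg _)
  obtain ⟨ρ₁, ρ₂, hsum, h₁, h₂⟩ : ∃ ρ₁ ρ₂ : ι → 𝕜, ρ₁ + ρ₂ = ρ ∧ vecNorm2 ρ₁ ≤ s ∧
      vecNorm2 ρ₂ ≤ t := by
    rcases (add_nonneg hs0 ht0).eq_or_lt' with h0 | h0
    · exact ⟨ρ, 0, add_zero _, by linarith [vecNorm2_nonneg ρ], by rwa [vecNorm2_zero]⟩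
    · have key : ∀ w : ℝ, 0 ≤ w → vecNorm2 (((w / (s + t) : ℝ) : 𝕜) • ρ) ≤ w := by
        intro w hw
        rw [vecNorm2_smul, RCLike.norm_ofReal, abs_of_nonneg (by positivity), div_mul_eq_mul_div,
          div_le_iff₀ h0]
        exact mul_le_mul_of_nonneg_left h hw
      refine ⟨_, _, ?_, key s hs0, key t ht0⟩
      rw [← add_smul, ← RCLike.ofReal_add, ← add_div, div_self h0.ne', RCLike.ofReal_one, one_smul]
  refine ⟨Matrix.vecMulVec ((((vecNorm2 x ^ 2)⁻¹ : ℝ) : 𝕜) • ρ₁) (star x), -ρ₂, ?_, ?_, ?_⟩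
  · have h3 : (Matrix.vecMulVec ((((vecNorm2 x ^ 2)⁻¹ : ℝ) : 𝕜) • ρ₁) (star x)).mulVec x = ρ₁ := by
      rw [Matrix.vecMulVec_mulVec, star_dotProduct_self]
      -- If `x = 0`, the allowance `s` vanishes and with it `ρ₁`, so the convention `0⁻¹ = 0` does
      -- no harm.
      by_cases hx : vecNorm2 x = 0
      · have : vecNorm2 ρ₁ = 0 := le_antisymm (by rw [hs, hx, mul_zero] at h₁; exact h₁)
          (vecNorm2_nonneg _)
        have h0 : ρ₁ = 0 := by
          funext i
          have := norm_le_vecNorm2 ρ₁ i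
          rw [‹vecNorm2 ρ₁ = 0›] at this
          simpa using this
        rw [h0]
        simp
      · funext i
        have hx' : ((vecNorm2 x : ℝ) : 𝕜) ≠ 0 := by exact_mod_cast hx
        simp only [Pi.smul_apply, smul_eq_mul, MulOpposite.smul_eq_mul_unop, MulOpposite.unop_op]
        push_cast
        field_simp
    rw [Matrix.add_mulVec, h3, ← sub_eq_iff_eq_add', ← sub_eq_zero]
    have : ρ₁ = ρ - ρ₂ := by rw [← hsum]; abel
    rw [this, hρ]
    abel
  · refine norm2_le hε fun v => ?_
    rw [Matrix.vecMulVec_mulVec]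
    have e1 : (MulOpposite.op (star x ⬝ᵥ v)) • (((((vecNorm2 x ^ 2)⁻¹ : ℝ) : 𝕜)) • ρ₁) =
        ((star x ⬝ᵥ v) * (((vecNorm2 x ^ 2)⁻¹ : ℝ) : 𝕜)) • ρ₁ := by
      funext i
      simp only [Pi.smul_apply, smul_eq_mul, MulOpposite.smul_eq_mul_unop, MulOpposite.unop_op]
      ring
    rw [e1, vecNorm2_smul, norm_mul, RCLike.norm_ofReal, abs_of_nonneg (by positivity)]
    rcases (vecNorm2_nonneg x).eq_or_lt' with hx | hx
    · rw [hx]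
      simp only [ne_eq, OfNat.ofNat_ne_zero, not_false_eq_true, zero_pow, inv_zero, mul_zero, zero_mul]
      exact mul_nonneg hε (vecNorm2_nonneg _)
    · have h5 := norm_star_dotProduct_le x v
      calc ‖star x ⬝ᵥ v‖ * (vecNorm2 x ^ 2)⁻¹ * vecNorm2 ρ₁
          ≤ (vecNorm2 x * vecNorm2 v) * (vecNorm2 x ^ 2)⁻¹ * (ε * μ * vecNorm2 x) := by
            refine mul_le_mul (mul_le_mul_of_nonneg_right h5 (by positivity)) h₁
              (vecNorm2_nonneg _) ?_
            have := vecNorm2_nonneg v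
            positivity
        _ = ε * μ * vecNorm2 v := by field_simp
  · rw [show -ρ₂ = (-1 : 𝕜) • ρ₂ by simp, vecNorm2_smul]
    simpa using h₂

end BackwardError

/-! ## The coefficient matrices -/

section Coefficients

variable {r n : ℕ} (S : PeriodicSystem r n)

/-- The blocks `B_kᵀ ⊗ A_k` and `D_kᵀ ⊗ C_k` have columns of norm at most `μ`. -/
structure PeriodicSystem.ColBound (μ : ℝ) : Prop where
  AB : ∀ k q, ∑ p, ‖((S.B k).transpose ⊗ₖ S.A k) p q‖ ^ 2 ≤ μ ^ 2
  CD : ∀ k q, ∑ p, ‖((S.D k).transpose ⊗ₖ S.C k) p q‖ ^ 2 ≤ μ ^ 2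

theorem mul_commMat_apply (K : Matrix (Fin n × Fin n) (Fin n × Fin n) ℂ) (p q : Fin n × Fin n) :
    (K * commMat n) p q = K p q.swap := by
  have e : ∀ t : Fin n × Fin n, q = t.swap ↔ t = q.swap := fun t => by
    constructor
    · rintro rfl; rw [Prod.swap_swap]
    · rintro rfl; rw [Prod.swap_swap]
  simp only [Matrix.mul_apply, commMat, e, mul_ite, mul_one, mul_zero, Finset.sum_ite_eq',
    Finset.mem_univ, if_true]

theorem matT_diag (hr : r ≠ 1) (k : Fin r) (p q : Fin n × Fin n) :
    S.matT (k, p) (k, q) = ((S.B k).transpose ⊗ₖ S.A k) p q := by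
  have h1 : ¬ (k.val + 1 = r ∧ k.val = 0) := by omega
  simp [PeriodicSystem.matT, PeriodicSystem.plainPart, PeriodicSystem.wrapPart, h1]

/-- In the wrapped block the commutation matrix permutes the columns, which the swap of `q` undoes.
The condition `r ≠ 1` separates `cyc k` from `k`, so nothing is added to this block. -/
theorem norm_matT_next (hr : r ≠ 1) (k : Fin r) (p q : Fin n × Fin n) :
    ‖S.matT (k, p) (cyc k, if k.val + 1 < r then q else q.swap)‖ =
      ‖((S.D k).transpose ⊗ₖ S.C k) p q‖ := by
  have hk := k.2
  have hc := cyc_ne hr k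
  by_cases h : k.val + 1 < r
  · have h1 : ¬ (k.val + 1 = r) := by omega
    have h2 : (cyc k).val = k.val + 1 := by rw [cyc_of_lt h]
    simp only [PeriodicSystem.matT, PeriodicSystem.plainPart, PeriodicSystem.wrapPart,
      Matrix.add_apply, hc, h, h1, h2, if_true, if_false, false_and, zero_add, add_zero, norm_neg]
  · have h1 : k.val + 1 = r := by omega
    have h2 : (cyc k).val = 0 := by rw [cyc_of_eq h1]
    rw [if_neg h]
    simp only [PeriodicSystem.matT, PeriodicSystem.plainPart, PeriodicSystem.wrapPart,
      Matrix.add_apply, hc, h1, h2, if_true, if_false, and_self, zero_add,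
      mul_commMat_apply, Prod.swap_swap]
    rw [if_neg (by omega), zero_add, norm_neg]

theorem colBound_of_matT (hr : r ≠ 1) {μ : ℝ}
    (h : ∀ b, ∑ a, ‖S.matT a b‖ ^ 2 ≤ μ ^ 2) : S.ColBound μ := by
  have key : ∀ k b, ∑ p, ‖S.matT (k, p) b‖ ^ 2 ≤ μ ^ 2 := fun k b => by
    refine le_trans ?_ (h b)
    rw [Fintype.sum_prod_type (fun a => ‖S.matT a b‖ ^ 2)]
    exact Finset.single_le_sum (f := fun k => ∑ p, ‖S.matT (k, p) b‖ ^ 2)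
      (fun _ _ => Finset.sum_nonneg fun _ _ => sq_nonneg _) (Finset.mem_univ k)
  constructor
  · intro k q
    simpa only [matT_diag S hr] using key k (k, q)
  · intro k q
    simpa only [norm_matT_next S hr] using key k (cyc k, if k.val + 1 < r then q else q.swap)

/-- On a real unknown conjugation has no effect, so these columns of the real matrix are the real
and imaginary parts of the columns of `matT`. The column bounds for `⋆ = H` thus follow from the
case `⋆ = ⊤`. -/
theorem sum_matH_col (b : Idx r n) :
    ∑ a, ‖S.matH a (b, 0)‖ ^ 2 = ∑ a, ‖S.matT a b‖ ^ 2 := by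
  rw [Fintype.sum_prod_type]
  refine Finset.sum_congr rfl fun a _ => ?_
  rw [Fin.sum_univ_two, ← Complex.normSq_eq_norm_sq, Complex.normSq_apply]
  simp [PeriodicSystem.matH, PeriodicSystem.matT, mulForm, conjForm]
  ring

theorem colBound_of_eq_one (hr : r = 1) {𝕜 ι : Type} [RCLike 𝕜] [Fintype ι] [DecidableEq ι]
    (M : Matrix ι ι 𝕜) : S.ColBound (refSize S M) := by
  subst hr
  have hk : ∀ k : Fin 1, k = ⟨0, by omega⟩ := fun k => Subsingleton.elim _ _
  rw [refSize, dif_pos rfl]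
  constructor
  · intro k q
    rw [hk k]
    refine (sum_col_sq_le _ q).trans (pow_le_pow_left₀ (norm2_nonneg _) ?_ 2)
    exact le_add_of_nonneg_right (norm2_nonneg _)
  · intro k q
    rw [hk k]
    refine (sum_col_sq_le _ q).trans (pow_le_pow_left₀ (norm2_nonneg _) ?_ 2)
    exact le_add_of_nonneg_left (norm2_nonneg _)

theorem colBound_matT : S.ColBound (refSize S S.matT) := by
  by_cases hr : r = 1
  · exact colBound_of_eq_one S hr _
  · rw [refSize, dif_neg hr]
    exact colBound_of_matT S hr (sum_col_sq_le S.matT)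

theorem colBound_matH : S.ColBound (refSize S S.matH) := by
  by_cases hr : r = 1
  · exact colBound_of_eq_one S hr _
  · rw [refSize, dif_neg hr]
    refine colBound_of_matT S hr fun b => ?_
    rw [← sum_matH_col]
    exact sum_col_sq_le S.matH (b, 0)

theorem refSize_nonneg {𝕜 ι : Type} [RCLike 𝕜] [Fintype ι] [DecidableEq ι]
    (M : Matrix ι ι 𝕜) : 0 ≤ refSize S M := by
  unfold refSize
  split_ifs
  · exact add_nonneg (norm2_nonneg _) (norm2_nonneg _)
  · exact norm2_nonneg _

/-- The left-hand sides of the periodic system. -/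
noncomputable def periodicMap (st : StarKind) (X : Fin r → Matrix (Fin n) (Fin n) ℂ) (k : Fin r) :
    Matrix (Fin n) (Fin n) ℂ :=
  S.A k * X k * S.B k - S.C k * nextX st X k * S.D k

theorem plainPart_mulVec (X : Fin r → Matrix (Fin n) (Fin n) ℂ) (k : Fin r) (p : Fin n × Fin n) :
    S.plainPart.mulVec (stack X) (k, p) = (S.A k * X k * S.B k).vec p -
      if k.val + 1 < r then (S.C k * X (cyc k) * S.D k).vec p else 0 := by
  have h1 : ∀ (A B Y : Matrix (Fin n) (Fin n) ℂ),
      (A * Y * B).vec p = ∑ q, (B.transpose ⊗ₖ A) p q * Y.vec q := fun A B Y => by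
    have := congrFun (Matrix.kronecker_mulVec_vec A Y B.transpose) p
    rw [Matrix.transpose_transpose] at this
    exact this.symm
  rw [Matrix.mulVec, dotProduct, Fintype.sum_prod_type]
  simp only [PeriodicSystem.plainPart, stack, add_mul, Finset.sum_add_distrib, ite_mul, zero_mul,
    Finset.sum_ite_irrel, Finset.sum_const_zero, neg_mul, Finset.sum_neg_distrib]
  rw [Finset.sum_ite_eq' Finset.univ k, if_pos (Finset.mem_univ k), ← h1, sub_eq_add_neg]
  congr 1
  by_cases h : k.val + 1 < r
  · have e : ∀ k' : Fin r, k'.val = k.val + 1 ↔ k' = cyc k := fun k' => by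
      rw [cyc_of_lt h, Fin.ext_iff]
    simp only [e]
    rw [Finset.sum_ite_eq', if_pos (Finset.mem_univ _), if_pos h, h1]
  · rw [if_neg h, neg_zero]
    refine Finset.sum_eq_zero fun k' _ => if_neg ?_
    have := k'.2
    omega

theorem wrapPart_mulVec (st : StarKind) (X : Fin r → Matrix (Fin n) (Fin n) ℂ) (k : Fin r)
    (p : Fin n × Fin n) :
    S.wrapPart.mulVec (fun b => st.entry (stack X b)) (k, p) =
      if k.val + 1 < r then 0 else -(S.C k * st.mat (X (cyc k)) * S.D k).vec p := by
  have hk := k.2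
  rw [Matrix.mulVec, dotProduct, Fintype.sum_prod_type]
  by_cases h : k.val + 1 < r
  · have h1 : ¬ (k.val + 1 = r) := by omega
    rw [if_pos h]
    simp [PeriodicSystem.wrapPart, h1]
  · have h1 : k.val + 1 = r := by omega
    have e : ∀ k' : Fin r, k'.val = 0 ↔ k' = cyc k := fun k' => by
      rw [cyc_of_eq h1, Fin.ext_iff]
    rw [if_neg h]
    simp only [PeriodicSystem.wrapPart, h1, true_and, e, ite_mul, zero_mul, Finset.sum_ite_irrel,
      Finset.sum_const_zero]
    rw [Finset.sum_ite_eq', if_pos (Finset.mem_univ _)]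
    have h2 := congrFun (Matrix.kronecker_mulVec_vec (S.C k) (st.mat (X (cyc k)))
      (S.D k).transpose) p
    rw [Matrix.transpose_transpose] at h2
    rw [← h2, Matrix.mulVec, dotProduct, ← Finset.sum_neg_distrib,
      ← (Equiv.prodComm (Fin n) (Fin n)).sum_comp]
    refine Finset.sum_congr rfl fun q _ => ?_
    rw [mul_commMat_apply, neg_mul]
    congr 2
    cases st <;> rfl

theorem plainPart_add_wrapPart (st : StarKind) (X : Fin r → Matrix (Fin n) (Fin n) ℂ) :
    S.plainPart.mulVec (stack X) + S.wrapPart.mulVec (fun b => st.entry (stack X b)) =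
      stack (periodicMap S st X) := by
  funext ⟨k, p⟩
  have hk := k.2
  rw [Pi.add_apply, plainPart_mulVec, wrapPart_mulVec, stack, periodicMap, nextX]
  by_cases h : k.val + 1 < r
  · rw [if_pos h, if_pos h, dif_pos h, cyc_of_lt h, add_zero]
    rfl
  · rw [if_neg h, if_neg h, dif_neg h, cyc_of_eq (by omega), sub_zero, ← sub_eq_add_neg]
    rfl

theorem matT_mulVec (X : Fin r → Matrix (Fin n) (Fin n) ℂ) :
    S.matT.mulVec (stack X) = stack (periodicMap S .T X) := by
  rw [← plainPart_add_wrapPart, PeriodicSystem.matT, Matrix.add_mulVec]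
  rfl

theorem matH_mulVec (X : Fin r → Matrix (Fin n) (Fin n) ℂ) :
    S.matH.mulVec (realStack (stack X)) = realStack (stack (periodicMap S .H X)) := by
  rw [← plainPart_add_wrapPart]
  funext ⟨a, t⟩
  have e : ∀ (x : Idx r n → ℂ) b s, realStack x (b, s) = reIm (x b) s := fun _ _ _ => rfl
  rw [Matrix.mulVec, dotProduct, Fintype.sum_prod_type, e]
  simp only [e, PeriodicSystem.matH, add_mul, Finset.sum_add_distrib, sum_mulForm,
    sum_conjForm]
  have h1 : ∀ f : Idx r n → ℂ, ∑ b, reIm (f b) t = reIm (∑ b, f b) t := fun f => by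
    unfold reIm
    split_ifs
    · rw [Complex.re_sum]
    · rw [Complex.im_sum]
  have h2 : ∀ y z : ℂ, reIm y t + reIm z t = reIm (y + z) t := fun y z => by
    unfold reIm
    split_ifs <;> simp
  rw [h1, h1, h2]
  rfl

theorem vecNorm2_realStack {ι : Type} [Fintype ι] (x : ι → ℂ) :
    vecNorm2 (realStack x) = vecNorm2 x := by
  have h : ∑ a, ‖realStack x a‖ ^ 2 = ∑ a, ‖x a‖ ^ 2 := by
    rw [Fintype.sum_prod_type]
    refine Finset.sum_congr rfl fun a _ => ?_
    rw [Fin.sum_univ_two, ← Complex.normSq_eq_norm_sq, Complex.normSq_apply]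
    simp [realStack]
    ring
  rw [← vecNorm2_sq, ← vecNorm2_sq] at h
  exact (pow_left_inj₀ (vecNorm2_nonneg _) (vecNorm2_nonneg _) two_ne_zero).1 h

theorem realStack_sub {ι : Type} (x y : ι → ℂ) :
    realStack x - realStack y = realStack (x - y) := by
  funext a
  simp only [realStack, Pi.sub_apply]
  split_ifs <;> simp

end Coefficients

/-! ## The norm of the residual -/

section Residual

variable {r n : ℕ} {S : PeriodicSystem r n}

theorem norm_diag_le {A B : Matrix (Fin n) (Fin n) ℂ} {μ : ℝ} (hμ : 0 ≤ μ)
    (h : ∀ q, ∑ p, ‖(B.transpose ⊗ₖ A) p q‖ ^ 2 ≤ μ ^ 2) (i j : Fin n) :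
    ‖A i i * B j j‖ ≤ μ := by
  refine le_of_sq_le_sq ?_ hμ
  have h1 : A i i * B j j = (B.transpose ⊗ₖ A) (j, i) (j, i) := mul_comm _ _
  rw [h1]
  exact (Finset.single_le_sum (f := fun p => ‖(B.transpose ⊗ₖ A) p (j, i)‖ ^ 2)
    (fun _ _ => sq_nonneg _) (Finset.mem_univ (j, i))).trans (h (j, i))

/-- `|A| |X| |B|` is the entrywise modulus of `Bᵀ ⊗ A` applied to `|vec X|`. Taking moduli can
enlarge the spectral norm but not the Frobenius norm, which the `n²` column bounds limit to `n μ`.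
-/
theorem sum_absProd_sq_le {A B : Matrix (Fin n) (Fin n) ℂ} {μ : ℝ}
    (h : ∀ q, ∑ p, ‖(B.transpose ⊗ₖ A) p q‖ ^ 2 ≤ μ ^ 2) (X : Matrix (Fin n) (Fin n) ℂ) :
    ∑ p : Fin n × Fin n, absProd A X B p.2 p.1 ^ 2 ≤
      (n * μ) ^ 2 * ∑ q, ‖X.vec q‖ ^ 2 := by
  have h1 : ∀ p : Fin n × Fin n, absProd A X B p.2 p.1 =
      ∑ q, ‖(B.transpose ⊗ₖ A) p q‖ * ‖X.vec q‖ := by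
    rintro ⟨j, i⟩
    rw [Fintype.sum_prod_type_right, absProd]
    refine Finset.sum_congr rfl fun t _ => ?_
    rw [Finset.mul_sum]
    refine Finset.sum_congr rfl fun b _ => ?_
    simp only [Matrix.kroneckerMap_apply, Matrix.transpose_apply, Matrix.vec, norm_mul]
    ring
  have h2 : ∀ p : Fin n × Fin n, absProd A X B p.2 p.1 ^ 2 ≤
      (∑ q, ‖(B.transpose ⊗ₖ A) p q‖ ^ 2) * ∑ q, ‖X.vec q‖ ^ 2 := fun p => by
    rw [h1]
    exact Finset.sum_mul_sq_le_sq_mul_sq _ _ _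
  refine (Finset.sum_le_sum fun p _ => h2 p).trans ?_
  rw [← Finset.sum_mul, Finset.sum_comm]
  refine mul_le_mul_of_nonneg_right ?_ (Finset.sum_nonneg fun _ _ => sq_nonneg _)
  refine (Finset.sum_le_sum fun q _ => h q).trans (le_of_eq ?_)
  simp only [Finset.sum_const, Finset.card_univ, Fintype.card_prod, Fintype.card_fin, nsmul_eq_mul]
  push_cast
  ring

/-- Passing from `X_k` to `X_{k+1}` permutes the unknowns and at most conjugates some of them. -/
theorem sum_nextX_sq (st : StarKind) (X : Fin r → Matrix (Fin n) (Fin n) ℂ) :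
    ∑ k, ∑ q, ‖(nextX st X k).vec q‖ ^ 2 = vecNorm2 (stack X) ^ 2 := by
  have h1 : ∀ k, ∑ q, ‖(nextX st X k).vec q‖ ^ 2 = ∑ q, ‖(X (cyc k)).vec q‖ ^ 2 := fun k => by
    simp only [Matrix.vec, nextX_apply]
    by_cases h : k.val + 1 < r
    · simp only [h, if_true]
    · simp only [h, if_false, StarKind.norm_entry]
      exact (Equiv.prodComm (Fin n) (Fin n)).sum_comp
        fun q : Fin n × Fin n => ‖X (cyc k) q.2 q.1‖ ^ 2
  rw [vecNorm2_sq, Fintype.sum_prod_type, Finset.sum_congr rfl fun k _ => h1 k,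
    sum_cyc fun k => ∑ q, ‖(X k).vec q‖ ^ 2]
  rfl

theorem vecNorm2_absProd_le {A B : Fin r → Matrix (Fin n) (Fin n) ℂ} {μ : ℝ} (hμ : 0 ≤ μ)
    (h : ∀ k q, ∑ p, ‖((B k).transpose ⊗ₖ A k) p q‖ ^ 2 ≤ μ ^ 2)
    (X : Fin r → Matrix (Fin n) (Fin n) ℂ) {N : ℝ} (hN : 0 ≤ N)
    (hX : ∑ k, ∑ q, ‖(X k).vec q‖ ^ 2 = N ^ 2) :
    vecNorm2 (fun a : Idx r n => absProd (A a.1) (X a.1) (B a.1) a.2.2 a.2.1) ≤ n * μ * N := by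
  refine vecNorm2_le_of_sq_le (by positivity) ?_
  rw [Fintype.sum_prod_type, mul_pow, ← hX, Finset.mul_sum]
  refine Finset.sum_le_sum fun k _ => ?_
  simp only [Real.norm_eq_abs, sq_abs]
  exact sum_absProd_sq_le (h k) (X k)

/-- Two factors `√r` meet here: Cauchy-Schwarz in the sum over `k`, and the repetition of the same
sum in all `r` equations. -/
theorem vecNorm2_entrySum_le (X : Fin r → Matrix (Fin n) (Fin n) ℂ) :
    vecNorm2 (fun a : Idx r n => entrySum X a.2.2 a.2.1) ≤ 2 * r * vecNorm2 (stack X) := by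
  refine vecNorm2_le_of_sq_le (mul_nonneg (by positivity) (vecNorm2_nonneg _)) ?_
  have h1 : ∀ i j, entrySum X i j ^ 2 ≤ r * ∑ k, 2 * (‖X k i j‖ ^ 2 + ‖X k j i‖ ^ 2) := by
    intro i j
    refine sq_sum_le_card_mul_sum_sq.trans ?_
    rw [Finset.card_univ, Fintype.card_fin]
    gcongr with k
    nlinarith [sq_nonneg (‖X k i j‖ - ‖X k j i‖)]
  rw [Fintype.sum_prod_type]
  simp only [Real.norm_eq_abs, sq_abs, Finset.sum_const, Finset.card_univ, Fintype.card_fin,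
    nsmul_eq_mul]
  have h2 : ∑ p : Fin n × Fin n, entrySum X p.2 p.1 ^ 2 ≤
      r * (4 * vecNorm2 (stack X) ^ 2) := by
    refine (Finset.sum_le_sum fun p _ => h1 p.2 p.1).trans (le_of_eq ?_)
    rw [← Finset.mul_sum, Finset.sum_comm, vecNorm2_sq, Fintype.sum_prod_type, Finset.mul_sum _ _ (4 : ℝ)]
    congr 1
    refine Finset.sum_congr rfl fun k _ => ?_
    rw [← Finset.mul_sum, Finset.sum_add_distrib]
    have h3 : ∑ p : Fin n × Fin n, ‖X k p.1 p.2‖ ^ 2 = ∑ p : Fin n × Fin n, ‖X k p.2 p.1‖ ^ 2 :=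
      (Equiv.prodComm (Fin n) (Fin n)).sum_comp fun p : Fin n × Fin n => ‖X k p.2 p.1‖ ^ 2
    rw [h3]
    simp only [stack, Matrix.vec]
    ring
  have := mul_le_mul_of_nonneg_left h2 (Nat.cast_nonneg (α := ℝ) r)
  linarith

theorem vecNorm2_smul_real {ι : Type} [Fintype ι] {c : ℝ} (hc : 0 ≤ c) (x : ι → ℝ) :
    vecNorm2 (fun i => c * x i) = c * vecNorm2 x := by
  have := vecNorm2_smul c x
  rwa [Real.norm_of_nonneg hc] at this

theorem residual_le {u : ℝ} (flR : FloatArith ℝ u) (flC : FloatArith ℂ u) (st : StarKind)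
    (hu : 0 ≤ u) (hr : 16000 * (r * u) ≤ 1) (hn : 100 * (n * u) ≤ 1)
    (hS : S.IsTriangular) {μ : ℝ} (hμ : 0 ≤ μ) (hc : S.ColBound μ)
    (hd : NoBreakdown flR flC st S) :
    let X := computedX flR flC st S
    vecNorm2 (stack S.E - stack (periodicMap S st X)) ≤
      (40 * (n * (n * u)) + 800000 * (r * (r * u))) * μ * vecNorm2 (stack X) +
        20 * (n * u) * vecNorm2 (stack S.E) := by
  intro X
  set e : Idx r n → ℝ := fun a => ‖stack S.E a‖
  set f : Idx r n → ℝ := fun a => absProd (S.A a.1) (X a.1) (S.B a.1) a.2.2 a.2.1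
  set g : Idx r n → ℝ := fun a => absProd (S.C a.1) (nextX st X a.1) (S.D a.1) a.2.2 a.2.1
  set h : Idx r n → ℝ := fun a => entrySum X a.2.2 a.2.1
  have hnu : 0 ≤ 20 * (n * u) := by positivity
  have hru : 0 ≤ 400000 * (r * u) * μ := by positivity
  have h1 : vecNorm2 (stack S.E - stack (periodicMap S st X)) ≤
      vecNorm2 ((fun a => 20 * (n * u) * (e + (f + g)) a) + fun a => 400000 * (r * u) * μ * h a) := by
    refine vecNorm2_le_of_le fun ⟨k, j, i⟩ => ?_
    exact (entry_residual flR flC st S hu hr hn hS hμ (fun k => norm_diag_le hμ (hc.AB k))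
      (fun k => norm_diag_le hμ (hc.CD k)) hd k i j).trans (Real.le_norm_self _)
  have he : vecNorm2 e ≤ vecNorm2 (stack S.E) := vecNorm2_le_of_le fun a => by simp [e]
  have hf : vecNorm2 f ≤ n * μ * vecNorm2 (stack X) :=
    vecNorm2_absProd_le hμ hc.AB X (vecNorm2_nonneg _) (by
      rw [vecNorm2_sq, Fintype.sum_prod_type]
      rfl)
  have hg : vecNorm2 g ≤ n * μ * vecNorm2 (stack X) :=
    vecNorm2_absProd_le hμ hc.CD (nextX st X) (vecNorm2_nonneg _) (sum_nextX_sq st X)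
  have hh : vecNorm2 h ≤ 2 * r * vecNorm2 (stack X) := vecNorm2_entrySum_le X
  have h2 : vecNorm2 (e + (f + g)) ≤
      vecNorm2 (stack S.E) + (n * μ * vecNorm2 (stack X) + n * μ * vecNorm2 (stack X)) :=
    (vecNorm2_add_le _ _).trans (add_le_add he ((vecNorm2_add_le _ _).trans (add_le_add hf hg)))
  refine h1.trans ((vecNorm2_add_le _ _).trans ?_)
  rw [vecNorm2_smul_real hnu, vecNorm2_smul_real hru]
  have h3 := mul_le_mul_of_nonneg_left h2 hnu
  have h4 := mul_le_mul_of_nonneg_left hh hru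
  linarith

theorem le_gam {c u : ℝ} {k : ℕ} (h : c * k * u < 1) (h0 : 0 ≤ c * k * u) :
    c * k * u ≤ gam c u k := by
  rw [gam, le_div_iff₀ (by linarith)]
  nlinarith

end Residual

end StarSylvester

theorem theorem7p4 :
    ∃ c : ℝ, 0 < c ∧
      ∀ (r n : ℕ) (u : ℝ), 0 ≤ u → c * r * u < 1 → c * (n ^ 2 : ℕ) * u < 1 →
      ∀ (flR : StarSylvester.FloatArith ℝ u) (flC : StarSylvester.FloatArith ℂ u)
        (S : StarSylvester.PeriodicSystem r n),
        (∀ k, (S.A k).BlockTriangular id) → (∀ k, (S.C k).BlockTriangular id) →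
        (∀ k, (S.B k).transpose.BlockTriangular id) →
        (∀ k, (S.D k).transpose.BlockTriangular id) →
        (StarSylvester.NoBreakdown flR flC .T S →
          StarSylvester.HasBackwardError S.matT (StarSylvester.stack S.E)
            (StarSylvester.stack (StarSylvester.computedX flR flC .T S))
            (StarSylvester.refSize S S.matT)
            (StarSylvester.matBound c u r n) (StarSylvester.gam c u (n ^ 2))) ∧
        (StarSylvester.NoBreakdown flR flC .H S →
          StarSylvester.HasBackwardError S.matH
            (StarSylvester.realStack (StarSylvester.stack S.E))
            (StarSylvester.realStack
              (StarSylvester.stack (StarSylvester.computedX flR flC .H S)))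
            (StarSylvester.refSize S S.matH)
            (StarSylvester.matBound c u r n) (StarSylvester.gam c u (n ^ 2))) := by
  -- The constant must exceed the coefficients `40`, `20` and `800000` of `residual_le` and ensure
  -- its smallness conditions on `r u` and `n u`.
  refine ⟨1000000, by norm_num, fun r n u hu hr hn flR flC S hA hC hB hD => ?_⟩
  have hS : S.IsTriangular := ⟨hA, hC, hB, hD⟩
  have hr0 : 0 ≤ 1000000 * (r : ℝ) * u := by positivity
  have hn0 : 0 ≤ 1000000 * ((n ^ 2 : ℕ) : ℝ) * u := by positivity
  have hgr := StarSylvester.le_gam hr hr0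
  have hgn := StarSylvester.le_gam hn hn0
  have hnn : (n : ℝ) * u ≤ (n ^ 2 : ℕ) * u := by
    refine mul_le_mul_of_nonneg_right ?_ hu
    exact_mod_cast Nat.le_self_pow two_ne_zero n
  have hη : 20 * (n * u) ≤ StarSylvester.gam 1000000 u (n ^ 2) := by
    have : 0 ≤ (n : ℝ) * u := by positivity
    linarith
  have hε : 40 * (n * (n * u)) + 800000 * (r * (r * u)) ≤
      StarSylvester.matBound 1000000 u r n := by
    have h1 := mul_le_mul_of_nonneg_left hgr (Nat.cast_nonneg (α := ℝ) r)
    have h2 : 0 ≤ StarSylvester.gam 1000000 u (n ^ 2) * (r * StarSylvester.gam 1000000 u r) :=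
      mul_nonneg (hn0.trans hgn) (mul_nonneg (Nat.cast_nonneg _) (hr0.trans hgr))
    have h3 : (0 : ℝ) ≤ r * (r * u) := by positivity
    have h4 : (0 : ℝ) ≤ n * (n * u) := by positivity
    unfold StarSylvester.matBound
    push_cast at hgn ⊢
    linarith
  have hε0 : 0 ≤ StarSylvester.matBound 1000000 u r n := le_trans (by positivity) hε
  have hη0 : 0 ≤ StarSylvester.gam 1000000 u (n ^ 2) := hn0.trans hgn
  have key : ∀ st {μ : ℝ}, 0 ≤ μ → S.ColBound μ → StarSylvester.NoBreakdown flR flC st S →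
      StarSylvester.vecNorm2 (StarSylvester.stack S.E - StarSylvester.stack
        (StarSylvester.periodicMap S st (StarSylvester.computedX flR flC st S))) ≤
      StarSylvester.matBound 1000000 u r n * μ *
          StarSylvester.vecNorm2 (StarSylvester.stack (StarSylvester.computedX flR flC st S)) +
        StarSylvester.gam 1000000 u (n ^ 2) * StarSylvester.vecNorm2 (StarSylvester.stack S.E) := by
    intro st μ hμ hc hd
    refine (StarSylvester.residual_le flR flC st hu (by linarith) (by linarith) hS hμ hc hd).trans ?_
    exact add_le_add
      (mul_le_mul_of_nonneg_right (mul_le_mul_of_nonneg_right hε hμ)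
        (StarSylvester.vecNorm2_nonneg _))
      (mul_le_mul_of_nonneg_right hη (StarSylvester.vecNorm2_nonneg _))
  constructor
  · intro hd
    have hμ := StarSylvester.refSize_nonneg S S.matT
    refine StarSylvester.hasBackwardError_of_residual (mul_nonneg hε0 hμ) hη0 ?_
    rw [StarSylvester.matT_mulVec]
    exact key .T hμ (StarSylvester.colBound_matT S) hd
  · intro hd
    have hμ := StarSylvester.refSize_nonneg S S.matH
    refine StarSylvester.hasBackwardError_of_residual (mul_nonneg hε0 hμ) hη0 ?_
    rw [StarSylvester.matH_mulVec, StarSylvester.realStack_sub, StarSylvester.vecNorm2_realStack,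
      StarSylvester.vecNorm2_realStack, StarSylvester.vecNorm2_realStack]
    exact key .H hμ (StarSylvester.colBound_matH S) hd
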